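/- Let $C\subset\mathbb{R}^2$ be an $o$-symmetric plane convex body, i.e. a compact convex set with non-empty interior and $C=-C$. The $C$-distance of points $p,q$ is their distance in the norm whose unit disk is $C$, and the $C$-length of a curve is the supremum of the $C$-lengths of the polygonal curves inscribed in it (sums of $C$-distances of consecutive vertices). For points $p,q$ at $C$-distance at most $2$, the arc-distance $\mathrm{arc}_C(p,q)$ is the minimum of the $C$-lengths of the arcs with endpoints $p$ and $q$ (the one-point arc if $p=q$) that are contained in the boundary of some translate of $C$. The $C$-spindle $[p,q]_C$ is the intersection of all translates of $C$ that contain both $p$ and $q$. The body $C$ is smooth if it has exactly one supporting line at each of its boundary points. Let $x,y,z\in\mathbb{R}^2$ be points whose pairwise $C$-distances are at most $2$. Then the arc-distances $\mathrm{arc}_C(x,y)$, $\mathrm{arc}_C(y,z)$, $\mathrm{arc}_C(x,z)$ exist (the minima are attained and finite), and: 1. if $y\in\operatorname{int}\,[x,z]_C$, then $\mathrm{arc}_C(x,y)+\mathrm{arc}_C(y,z)\le \mathrm{arc}_C(x,z)$; 2. if $y\in\operatorname{bd}\,[x,z]_C$, then $\mathrm{arc}_C(x,y)+\mathrm{arc}_C(y,z)=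 \mathrm{arc}_C(x,z)$; 3. if $y\notin[x,z]_C$ and $C$ is smooth, then $\mathrm{arc}_C(x,y)+\mathrm{arc}_C(y,z)\ge \mathrm{arc}_C(x,z)$. -/

import Mathlib

open scoped Pointwise ENNReal

/-- The Euclidean plane. -/
abbrev Plane : Type := EuclideanSpace ℝ (Fin 2)

/-- `C` is an origin-symmetric plane convex body: a compact convex set with non-empty interior
such that `C = -C`. -/
structure IsSymmPlaneBody (C : Set Plane) : Prop where
  convex : Convex ℝ C
  isCompact : IsCompact C
  interior_nonempty : (interior C).Nonempty
  neg_eq : -C = C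

/-- The `C`-distance of two points: the distance in the norm with unit disk `C`. -/
noncomputable def bodyDist (C : Set Plane) (p q : Plane) : ℝ :=
  gauge C (q - p)

/-- The `C`-length of the curve `γ` restricted to the parameter interval `[a, b]`: the supremum of
the `C`-lengths of the inscribed polygonal curves `γ (u 0), γ (u 1), …, γ (u n)`. -/
noncomputable def bodyLength (C : Set Plane) (γ : ℝ → Plane) (a b : ℝ) : ℝ≥0∞ :=
  ⨆ P : ℕ × {u : ℕ → ℝ // Monotone u ∧ ∀ i, u i ∈ Set.Icc a b},
    ∑ i ∈ Finset.range P.1,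
      ENNReal.ofReal (bodyDist C (γ ((P.2 : ℕ → ℝ) i)) (γ ((P.2 : ℕ → ℝ) (i + 1))))

/-- The restriction of `γ` to `[a, b]` is a (simple) arc with endpoints `p` and `q` contained
in `S`. For `p = q` the only such arc is the one-point arc, with `a = b`. -/
def IsArcIn (S : Set Plane) (γ : ℝ → Plane) (a b : ℝ) (p q : Plane) : Prop :=
  a ≤ b ∧ ContinuousOn γ (Set.Icc a b) ∧ Set.InjOn γ (Set.Icc a b) ∧
    γ a = p ∧ γ b = q ∧ ∀ t ∈ Set.Icc a b, γ t ∈ S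

/-- The set of the `C`-lengths of the arcs with endpoints `p` and `q` that are contained in the
boundary of some translate of `C`. -/
def arcLengths (C : Set Plane) (p q : Plane) : Set ℝ≥0∞ :=
  {l | ∃ (v : Plane) (γ : ℝ → Plane) (a b : ℝ),
    IsArcIn (frontier (v +ᵥ C)) γ a b p q ∧ l = bodyLength C γ a b}

/-- The arc-distance of `p` and `q` with respect to `C`. -/
noncomputable def arcDist (C : Set Plane) (p q : Plane) : ℝ≥0∞ :=
  sInf (arcLengths C p q)

/-- The arc-distance of `p` and `q` is really a minimum, and a finite one. -/
def ArcDistAttained (C : Set Plane) (p q : Plane) : Prop :=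
  IsLeast (arcLengths C p q) (arcDist C p q) ∧ arcDist C p q ≠ ⊤

/-- The `C`-spindle of `p` and `q`: the intersection of all translates of `C` that contain `p`
and `q` (the whole plane if there is no such translate). -/
def spindle (C : Set Plane) (p q : Plane) : Set Plane :=
  ⋂ (v : Plane) (_ : p ∈ v +ᵥ C) (_ : q ∈ v +ᵥ C), v +ᵥ C

/-- `L` is a supporting line of `C` at the point `p` of `C`. -/
def IsSupportingLineAt (C : Set Plane) (p : Plane) (L : Set Plane) : Prop :=
  ∃ f : Plane →L[ℝ] ℝ, f ≠ 0 ∧ (∀ w ∈ C, f w ≤ f p) ∧ L = {w | f w = f p}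

/-- `C` is smooth: there is only one supporting line at each of its boundary points. -/
def IsSmoothBody (C : Set Plane) : Prop :=
  ∀ p ∈ frontier C, ∀ L₁ L₂ : Set Plane,
    IsSupportingLineAt C p L₁ → IsSupportingLineAt C p L₂ → L₁ = L₂

/-!
Measure in the norm with unit disk `C`. The arc-distance of `p` and `q` is a function of the vector
`d = q - p` alone: it is the length `A d` of the shortest arc of the unit circle with chord vector
`d`, and such an arc is at most half a turn. Let `S` and `T` be counterclockwise supporting
directions at its endpoints, say independent ones. The linear functional with values `‖S‖` at `S`
and `‖T‖` at `T` grows at least as fast as the length along the arc and at most as fast along the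
complementary arc, which makes it a subgradient of `A` at `d`. So `A` is convex on the vectors of
norm at most two.

If `y` lies in the spindle, translate so that the shortest arc for `z - x` runs from `x` to `z` on
the unit circle, after exchanging `x` and `z` if necessary. The ray from `x` through `y` leaves the
disk at a point `q` of this arc, so `y = x + r (q - x)` with `0 ≤ r ≤ 1`. The upper bound follows
from the convexity of `A`, applied to `y - x = r (q - x)` and `z - y = (1 - r) (z - x) + r (z - q)`,
since the lengths of the two sub-arcs at `q` add up.

If `y` is not in the interior of the spindle, some translate of the disk contains `x` and `z` but
does not contain `y` in its interior; put its centre at the origin. If `y - x` and `z - y` both lie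
strictly between `S` and `T`, then so does, up to sign, the supporting direction `V` of the disk at
`y / ‖y‖`. The line in direction `V` touches the shortest arc for `z - x` at a point that splits it,
and the subgradients of the two sub-arcs give the lower bound. Otherwise the subgradient of the
whole arc already does. All this needs `‖z - x‖ < 2`, and the remaining case follows by shrinking
the triangle towards `y / ‖y‖`.
-/

open Set Filter Topology Metric Real

section NormedSpace

variable {E : Type*} [NormedAddCommGroup E] [NormedSpace ℝ E]

lemma norm_mul_norm_normalize_sub_normalize_le (x y : E) :
    ‖x‖ * ‖NormedSpace.normalize x - NormedSpace.normalize y‖ ≤ 2 * ‖x - y‖ := by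
  have hxy : ‖x‖ • (NormedSpace.normalize x - NormedSpace.normalize y) =
      (x - y) - (‖x‖ - ‖y‖) • NormedSpace.normalize y := by
    rw [smul_sub, sub_smul, NormedSpace.norm_smul_normalize, NormedSpace.norm_smul_normalize]
    abel
  have hy : ‖NormedSpace.normalize y‖ ≤ 1 := by
    rcases eq_or_ne y 0 with rfl | hy
    · simp
    · exact (NormedSpace.norm_normalize_eq_one_iff.2 hy).le
  calc ‖x‖ * ‖NormedSpace.normalize x - NormedSpace.normalize y‖
      = ‖(x - y) - (‖x‖ - ‖y‖) • NormedSpace.normalize y‖ := by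
        rw [← hxy, norm_smul, norm_norm]
    _ ≤ ‖x - y‖ + |‖x‖ - ‖y‖| * ‖NormedSpace.normalize y‖ := by
        simpa only [norm_smul, Real.norm_eq_abs] using
          norm_sub_le (x - y) ((‖x‖ - ‖y‖) • NormedSpace.normalize y)
    _ ≤ ‖x - y‖ + ‖x - y‖ * 1 := by
        gcongr
        exact abs_norm_sub_norm_le x y
    _ = 2 * ‖x - y‖ := by ring

lemma mul_norm_add_mul_norm_le_norm_smul_add_smul {a : ℝ} (ha : a ≤ 0) (b : ℝ) (x y : E) :
    a * ‖x‖ + b * ‖y‖ ≤ ‖a • x + b • y‖ := by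
  have hb : b * ‖y‖ ≤ ‖b • y‖ := by
    rw [norm_smul]
    exact mul_le_mul_of_nonneg_right (le_abs_self b) (norm_nonneg y)
  have h := norm_sub_norm_le (b • y) (-(a • x))
  rw [sub_neg_eq_add, add_comm (b • y), norm_neg, norm_smul a, Real.norm_of_nonpos ha] at h
  linarith

lemma exists_norm_eq_one_lineMap_eq {p y : E} (hp : ‖p‖ ≤ 1) (hy : ‖y‖ ≤ 1) (hyp : y ≠ p) :
    ∃ q : E, ‖q‖ = 1 ∧ ∃ r ∈ Ioc (0 : ℝ) 1, y = AffineMap.lineMap p q r := by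
  have hpos : 0 < ‖y - p‖ := norm_pos_iff.2 (sub_ne_zero.2 hyp)
  have hle : ‖y - p‖ ≤ 2 := (norm_sub_le y p).trans (by linarith)
  have h1 : 1 ≤ 2 / ‖y - p‖ := (one_le_div hpos).2 hle
  have hfar : 1 ≤ ‖p + (2 / ‖y - p‖) • (y - p)‖ := by
    have h := norm_sub_le_norm_add ((2 / ‖y - p‖) • (y - p)) p
    rw [norm_smul, Real.norm_of_nonneg (by positivity), div_mul_cancel₀ _ hpos.ne',
      add_comm _ p] at h
    linarith
  obtain ⟨k, hk, hk1⟩ := intermediate_value_Icc h1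
    (f := fun k : ℝ ↦ ‖p + k • (y - p)‖) (by fun_prop) ⟨by simpa using hy, hfar⟩
  have hk0 : 0 < k := one_pos.trans_le hk.1
  refine ⟨p + k • (y - p), hk1, k⁻¹, ⟨inv_pos.2 hk0, inv_le_one_of_one_le₀ hk.1⟩, ?_⟩
  rw [AffineMap.lineMap_apply_module', add_sub_cancel_left, inv_smul_smul₀ hk0.ne',
    sub_add_cancel]

end NormedSpace

lemma eVariationOn_Icc_le_ofReal_sub {α F : Type*} [LinearOrder α] [PseudoMetricSpace F]
    {f : α → F} {g : α → ℝ} {a b : α}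
    (h : ∀ x y, a ≤ x → x ≤ y → y ≤ b → dist (f x) (f y) ≤ g y - g x) :
    eVariationOn f (Icc a b) ≤ ENNReal.ofReal (g b - g a) := by
  have hmono : ∀ x y, a ≤ x → x ≤ y → y ≤ b → g x ≤ g y := fun x y hx hxy hy ↦
    sub_nonneg.1 (dist_nonneg.trans (h x y hx hxy hy))
  refine iSup_le fun ⟨n, u, hu, hmem⟩ ↦ ?_
  calc ∑ i ∈ Finset.range n, edist (f (u (i + 1))) (f (u i))
      ≤ ∑ i ∈ Finset.range n, ENNReal.ofReal (g (u (i + 1)) - g (u i)) := by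
        refine Finset.sum_le_sum fun i _ ↦ ?_
        rw [edist_comm, edist_dist]
        exact ENNReal.ofReal_le_ofReal (h _ _ (hmem i).1 (hu i.le_succ) (hmem (i + 1)).2)
    _ = ENNReal.ofReal (g (u n) - g (u 0)) := by
        rw [← ENNReal.ofReal_sum_of_nonneg fun i _ ↦ sub_nonneg.2
          (hmono _ _ (hmem i).1 (hu i.le_succ) (hmem (i + 1)).2),
          Finset.sum_range_sub fun i ↦ g (u i)]
    _ ≤ ENNReal.ofReal (g b - g a) := ENNReal.ofReal_le_ofReal (sub_le_sub
        (hmono _ _ (hmem n).1 (hmem n).2 le_rfl) (hmono _ _ le_rfl (hmem 0).1 (hmem 0).2))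

section Area

attribute [local instance] Complex.finrank_real_complex_fact

variable {E : Type*} [NormedAddCommGroup E] [NormedSpace ℝ E] (e : ℂ ≃L[ℝ] E)

/-- The oriented area of the parallelogram spanned by two vectors, measured in the linear
coordinates `e`. -/
noncomputable def area : E →ₗ[ℝ] E →ₗ[ℝ] ℝ :=
  Complex.orientation.areaForm.compl₁₂ (e.symm : E →ₗ[ℝ] ℂ) (e.symm : E →ₗ[ℝ] ℂ)

variable {e}

lemma area_apply (x y : E) :
    area e x y = (e.symm x).re * (e.symm y).im - (e.symm x).im * (e.symm y).re := by
  simp [area, Complex.areaForm]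
  ring

lemma area_self (x : E) : area e x x = 0 := by
  rw [area_apply]; ring

lemma area_swap (x y : E) : area e x y = -area e y x := by
  rw [area_apply, area_apply]; ring

lemma area_mul_area (a b c d : E) :
    area e a b * area e c d = area e a c * area e b d - area e a d * area e b c := by
  simp only [area_apply]; ring

lemma area_smul_eq (x y w : E) : area e x y • w = area e w y • x + area e x w • y := by
  apply e.symm.injective
  apply Complex.ext <;>
    simp only [area_apply, map_add, map_smul, Complex.add_re, Complex.add_im, Complex.smul_re,
      Complex.smul_im, smul_eq_mul] <;> ring

lemma area_mul_area_eq_add (x y v w : E) :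
    area e x y * area e v w = area e w y * area e v x + area e x w * area e v y := by
  simpa using congrArg (area e v) (area_smul_eq x y w)

lemma eq_smul_add_smul_of_area_ne_zero {x y : E} (h : area e x y ≠ 0) (w : E) :
    w = (area e w y / area e x y) • x + (area e x w / area e x y) • y := by
  rw [div_eq_inv_mul, div_eq_inv_mul, mul_smul, mul_smul, ← smul_add, ← area_smul_eq,
    inv_smul_smul₀ h]

lemma exists_area_eq_norm (y : E) : ∃ T, area e y T = ‖y‖ ∧ ∀ w, area e w T ≤ ‖w‖ := by
  obtain ⟨f, hf, hfy⟩ := exists_dual_vector'' ℝ y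
  have hfT : ∀ w, area e w (e ⟨-f (e Complex.I), f (e 1)⟩) = f w := fun w ↦ by
    have hw : w = (e.symm w).re • e 1 + (e.symm w).im • e Complex.I := by
      apply e.symm.injective
      apply Complex.ext <;> simp
    conv_rhs => rw [hw]
    simp [area_apply]
  refine ⟨_, (hfT y).trans hfy, fun w ↦ (hfT w).trans_le ?_⟩
  exact (le_abs_self _).trans ((f.le_of_opNorm_le hf w).trans_eq (one_mul _))

end Area

section CirclePoint

variable {E : Type*} [NormedAddCommGroup E] [NormedSpace ℝ E] (e : ℂ ≃L[ℝ] E)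

/-- The point of the unit circle of `E` in the direction of angle `θ` in the coordinates `e`. -/
noncomputable def circlePoint (θ : ℝ) : E :=
  NormedSpace.normalize (e (Circle.exp θ))

variable {e}

lemma apply_circleExp_ne_zero (θ : ℝ) : e (Circle.exp θ) ≠ 0 := by
  simp

lemma norm_circlePoint (θ : ℝ) : ‖circlePoint e θ‖ = 1 :=
  NormedSpace.norm_normalize_eq_one_iff.2 (apply_circleExp_ne_zero θ)

lemma circlePoint_add_pi (θ : ℝ) : circlePoint e (θ + π) = -circlePoint e θ := by
  simp [circlePoint, Circle.exp_add]

lemma circlePoint_sub_pi (θ : ℝ) : circlePoint e (θ - π) = -circlePoint e θ := by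
  rw [← neg_neg (circlePoint e (θ - π)), ← circlePoint_add_pi, sub_add_cancel]

lemma circlePoint_periodic : Function.Periodic (circlePoint e) (2 * π) := fun θ ↦ by
  rw [two_mul, ← add_assoc, circlePoint_add_pi, circlePoint_add_pi, neg_neg]

lemma exists_lipschitzWith_circlePoint : ∃ K, LipschitzWith K (circlePoint e) := by
  refine ⟨_, LipschitzWith.of_dist_le_mul (K := 2 * ‖(e : ℂ →L[ℝ] E)‖₊ * ‖(e.symm : E →L[ℝ] ℂ)‖₊)
    fun a b ↦ ?_⟩
  have hexp : ‖(Circle.exp a : ℂ) - Circle.exp b‖ ≤ |a - b| := by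
    have h : (Circle.exp a : ℂ) - Circle.exp b =
        Circle.exp b * (Complex.exp (Complex.I * ↑(a - b)) - 1) := by
      rw [mul_comm Complex.I, ← Circle.coe_exp, mul_sub_one, ← Circle.coe_mul, ← Circle.exp_add,
        add_sub_cancel]
    rw [h, norm_mul, Circle.norm_coe, one_mul]
    exact norm_exp_I_mul_ofReal_sub_one_le
  have hlow : 1 ≤ ‖(e.symm : E →L[ℝ] ℂ)‖ * ‖e (Circle.exp a)‖ := by
    simpa using (e.symm : E →L[ℝ] ℂ).le_opNorm (e (Circle.exp a))
  have hdiff : ‖e (Circle.exp a) - e (Circle.exp b)‖ ≤ ‖(e : ℂ →L[ℝ] E)‖ * |a - b| := by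
    rw [← map_sub]
    exact ((e : ℂ →L[ℝ] E).le_opNorm _).trans (by gcongr)
  have hnorm := norm_mul_norm_normalize_sub_normalize_le (e (Circle.exp a)) (e (Circle.exp b))
  rw [dist_eq_norm, Real.dist_eq]
  calc ‖circlePoint e a - circlePoint e b‖
      ≤ ‖(e.symm : E →L[ℝ] ℂ)‖ * ‖e (Circle.exp a)‖ * ‖circlePoint e a - circlePoint e b‖ :=
        le_mul_of_one_le_left (norm_nonneg _) hlow
    _ ≤ ‖(e.symm : E →L[ℝ] ℂ)‖ * (2 * (‖(e : ℂ →L[ℝ] E)‖ * |a - b|)) := by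
        rw [mul_assoc]
        exact mul_le_mul_of_nonneg_left (hnorm.trans (by gcongr)) (norm_nonneg _)
    _ = (2 * ‖(e : ℂ →L[ℝ] E)‖₊ * ‖(e.symm : E →L[ℝ] ℂ)‖₊ : NNReal) * |a - b| := by
        push_cast
        ring

lemma continuous_circlePoint : Continuous (circlePoint e) :=
  exists_lipschitzWith_circlePoint.choose_spec.continuous

lemma area_circlePoint (a b : ℝ) : area e (circlePoint e a) (circlePoint e b) =
    ‖e (Circle.exp a)‖⁻¹ * ‖e (Circle.exp b)‖⁻¹ * sin (b - a) := by
  rw [circlePoint, circlePoint, NormedSpace.normalize, NormedSpace.normalize, map_smul,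
    LinearMap.map_smul₂, area_apply, e.symm_apply_apply, e.symm_apply_apply, Circle.coe_exp,
    Circle.coe_exp, Complex.exp_ofReal_mul_I_re, Complex.exp_ofReal_mul_I_re,
    Complex.exp_ofReal_mul_I_im, Complex.exp_ofReal_mul_I_im, sin_sub, smul_eq_mul, smul_eq_mul]
  ring

lemma area_circlePoint_nonneg {a b : ℝ} (hab : a ≤ b) (hba : b ≤ a + π) :
    0 ≤ area e (circlePoint e a) (circlePoint e b) := by
  have := sin_nonneg_of_nonneg_of_le_pi (sub_nonneg.2 hab) (by linarith)
  rw [area_circlePoint]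
  positivity

lemma area_circlePoint_pos {a b : ℝ} (hab : a < b) (hba : b < a + π) :
    0 < area e (circlePoint e a) (circlePoint e b) := by
  have := sin_pos_of_pos_of_lt_pi (sub_pos.2 hab) (by linarith)
  have ha := norm_pos_iff.2 (apply_circleExp_ne_zero (e := e) a)
  have hb := norm_pos_iff.2 (apply_circleExp_ne_zero (e := e) b)
  rw [area_circlePoint]
  positivity

lemma area_circlePoint_neg {a b : ℝ} (hab : a + π < b) (hba : b < a + 2 * π) :
    area e (circlePoint e a) (circlePoint e b) < 0 := by
  have h := area_circlePoint_pos (e := e) (a := a) (b := b - π) (by linarith) (by linarith)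
  rw [circlePoint_sub_pi, map_neg] at h
  linarith

lemma exists_eq_norm_smul_circlePoint (w : E) (s : ℝ) :
    ∃ θ ∈ Ico s (s + 2 * π), w = ‖w‖ • circlePoint e θ := by
  obtain ⟨n, hn⟩ :=
    (existsUnique_add_zsmul_mem_Ico two_pi_pos (Complex.arg (e.symm w)) s).exists
  refine ⟨_, hn, ?_⟩
  rw [circlePoint_periodic.zsmul n, circlePoint]
  have hw : w = ‖e.symm w‖ • e (Circle.exp (Complex.arg (e.symm w))) := by
    rw [← map_smul, Complex.real_smul, Circle.coe_exp, Complex.norm_mul_exp_arg_mul_I,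
      e.apply_symm_apply]
  rcases eq_or_ne w 0 with rfl | hw0
  · simp
  · have hpos : 0 < ‖e.symm w‖ := norm_pos_iff.2 (by simpa using hw0)
    rw [← NormedSpace.normalize_smul_of_pos hpos, ← hw, NormedSpace.norm_smul_normalize]

lemma circlePoint_injOn (s : ℝ) : InjOn (circlePoint e) (Ico s (s + 2 * π)) := by
  suffices h : ∀ a b, a < b → b < a + 2 * π → circlePoint e a ≠ circlePoint e b by
    intro a ha b hb hab
    by_contra hne
    rcases lt_or_gt_of_ne hne with hlt | hlt
    · exact h a b hlt (by linarith [ha.1, hb.2]) hab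
    · exact h b a hlt (by linarith [hb.1, ha.2]) hab.symm
  intro a b hab hba heq
  have h0 : area e (circlePoint e a) (circlePoint e b) = 0 := by rw [heq, area_self]
  rcases lt_trichotomy b (a + π) with h | rfl | h
  · exact (area_circlePoint_pos hab h).ne' h0
  · rw [circlePoint_add_pi, ← add_eq_zero_iff_eq_neg, ← two_smul ℝ] at heq
    have h2 := congrArg norm heq
    rw [norm_smul, norm_circlePoint, norm_zero] at h2
    simp at h2
  · exact (area_circlePoint_neg h hba).ne h0

lemma exists_circlePoint_eq_smul_add_smul {a b c : ℝ} (hab : a ≤ b) (hbc : b ≤ c)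
    (hca : c < a + π) : ∃ α β : ℝ, 1 ≤ α + β ∧ β ≤ 1 + α ∧
      circlePoint e b = α • circlePoint e a + β • circlePoint e c := by
  rcases (hab.trans hbc).eq_or_lt with rfl | hac
  · exact ⟨1, 0, by simp [le_antisymm hab hbc]⟩
  have hpos := area_circlePoint_pos (e := e) hac hca
  have hb := eq_smul_add_smul_of_area_ne_zero hpos.ne' (circlePoint e b)
  have hα := div_nonneg (area_circlePoint_nonneg (e := e) hbc (by linarith)) hpos.le
  have hβ := div_nonneg (area_circlePoint_nonneg (e := e) hab (by linarith)) hpos.le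
  set α := area e (circlePoint e b) (circlePoint e c) / area e (circlePoint e a) (circlePoint e c)
  set β := area e (circlePoint e a) (circlePoint e b) / area e (circlePoint e a) (circlePoint e c)
  have hα1 : ‖α • circlePoint e a‖ = α := by
    rw [norm_smul, norm_circlePoint, mul_one, Real.norm_of_nonneg hα]
  have hβ1 : ‖β • circlePoint e c‖ = β := by
    rw [norm_smul, norm_circlePoint, mul_one, Real.norm_of_nonneg hβ]
  refine ⟨α, β, ?_, ?_, hb⟩
  · have h := norm_add_le (α • circlePoint e a) (β • circlePoint e c)
    rwa [← hb, norm_circlePoint, hα1, hβ1] at h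
  · have h := norm_sub_le (circlePoint e b) (α • circlePoint e a)
    rw [← eq_sub_of_add_eq' hb.symm, norm_circlePoint, hα1, hβ1] at h
    exact h

lemma area_sub_circlePoint_nonneg_of_lt_pi {a b c : ℝ} (hab : a ≤ b) (hbc : b ≤ c)
    (hca : c < a + π) :
    0 ≤ area e (circlePoint e b - circlePoint e a) (circlePoint e c - circlePoint e a) := by
  obtain ⟨α, β, hαβ, -, hb⟩ := exists_circlePoint_eq_smul_add_smul (e := e) hab hbc hca
  have hac := area_circlePoint_nonneg (e := e) (hab.trans hbc) hca.le
  have key : area e (circlePoint e b - circlePoint e a) (circlePoint e c - circlePoint e a) =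
      (α + β - 1) * area e (circlePoint e a) (circlePoint e c) := by
    rw [hb]
    simp only [map_sub, map_add, map_smul, LinearMap.sub_apply, LinearMap.add_apply,
      LinearMap.smul_apply, smul_eq_mul, area_self, area_swap (circlePoint e c) (circlePoint e a)]
    ring
  rw [key]
  exact mul_nonneg (by linarith) hac

lemma area_sub_circlePoint_nonneg {a b c : ℝ} (hab : a ≤ b) (hba : b ≤ a + π) (hbc : b ≤ c)
    (hca : c ≤ a + 2 * π) :
    0 ≤ area e (circlePoint e b - circlePoint e a) (circlePoint e c - circlePoint e a) := by
  have hcyc : area e (circlePoint e b - circlePoint e a) (circlePoint e c - circlePoint e a) =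
      area e (circlePoint e a) (circlePoint e b) + area e (circlePoint e b) (circlePoint e c) +
        area e (circlePoint e c) (circlePoint e a) := by
    rw [map_sub, LinearMap.map_sub₂, LinearMap.map_sub₂, area_self,
      area_swap (circlePoint e b) (circlePoint e a), area_swap (circlePoint e a) (circlePoint e c)]
    ring
  rcases lt_or_ge c (a + π) with h | hac
  · exact area_sub_circlePoint_nonneg_of_lt_pi hab hbc h
  rcases lt_or_ge (b + π) c with h | hcb
  · have := area_sub_circlePoint_nonneg_of_lt_pi (e := e) hca
      (add_le_add_left hab (2 * π)) (by linarith)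
    rw [circlePoint_periodic, circlePoint_periodic, map_sub, LinearMap.map_sub₂,
      LinearMap.map_sub₂, area_self] at this
    linarith [area_swap (e := e) (circlePoint e a) (circlePoint e c),
      area_swap (e := e) (circlePoint e c) (circlePoint e b)]
  · have hb := area_circlePoint_nonneg (e := e) hab hba
    have hc := area_circlePoint_nonneg (e := e) hbc hcb
    have ha := area_circlePoint_nonneg (e := e) hca (by linarith)
    rw [circlePoint_periodic] at ha
    linarith

end CirclePoint

section Support

variable {E : Type*} [NormedAddCommGroup E] [NormedSpace ℝ E] (e : ℂ ≃L[ℝ] E)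

/-- `T` is the counterclockwise direction of a line supporting the unit ball at `circlePoint e θ`,
normalized so that `area e · T` is a functional of norm one attaining its norm there. -/
structure IsSupport (θ : ℝ) (T : E) : Prop where
  eq_one : area e (circlePoint e θ) T = 1
  le_norm : ∀ w, area e w T ≤ ‖w‖

variable {e}

lemma exists_isSupport (θ : ℝ) : ∃ T, IsSupport e θ T := by
  obtain ⟨T, hT, hle⟩ := exists_area_eq_norm (e := e) (circlePoint e θ)
  exact ⟨T, by rw [hT, norm_circlePoint], hle⟩

namespace IsSupport

variable {s t θ : ℝ} {S T V : E}

lemma abs_area_le (hT : IsSupport e θ T) (w : E) : |area e w T| ≤ ‖w‖ :=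
  abs_le'.2 ⟨hT.le_norm w, by simpa using hT.le_norm (-w)⟩

lemma abs_area_circlePoint_le (hT : IsSupport e θ T) (φ : ℝ) :
    |area e (circlePoint e φ) T| ≤ 1 :=
  norm_circlePoint (e := e) φ ▸ hT.abs_area_le _

lemma sub_pi (hT : IsSupport e θ T) : IsSupport e (θ - π) (-T) where
  eq_one := by rw [circlePoint_sub_pi, map_neg, LinearMap.map_neg₂, neg_neg, hT.eq_one]
  le_norm w := by simpa using hT.le_norm (-w)

lemma of_circlePoint_eq {φ : ℝ} (hT : IsSupport e θ T) (h : circlePoint e φ = circlePoint e θ) :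
    IsSupport e φ T where
  eq_one := by rw [h, hT.eq_one]
  le_norm := hT.le_norm

lemma add_two_pi (hT : IsSupport e θ T) : IsSupport e (θ + 2 * π) T :=
  hT.of_circlePoint_eq (circlePoint_periodic θ)

lemma antitoneOn (hT : IsSupport e θ T) :
    AntitoneOn (fun φ ↦ area e (circlePoint e φ) T) (Icc θ (θ + π)) := by
  rintro a ⟨ha, -⟩ b ⟨-, hb⟩ hab
  have hA := abs_le.1 (hT.abs_area_circlePoint_le a)
  have hB := abs_le.1 (hT.abs_area_circlePoint_le b)
  rcases hb.lt_or_eq with hb | rfl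
  · obtain ⟨α, β, hαβ, hβα, ha_eq⟩ := exists_circlePoint_eq_smul_add_smul (e := e) ha hab hb
    have hval : area e (circlePoint e a) T = α + β * area e (circlePoint e b) T := by
      rw [ha_eq, LinearMap.map_add₂, LinearMap.map_smul₂, LinearMap.map_smul₂, hT.eq_one,
        smul_eq_mul, smul_eq_mul, mul_one]
    beta_reduce
    rcases le_total β 1 with hβ | hβ
    · nlinarith [mul_le_of_le_one_right (sub_nonneg.2 hβ) hB.2]
    · nlinarith [mul_le_mul_of_nonneg_left hB.1 (sub_nonneg.2 hβ)]
  · beta_reduce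
    rw [circlePoint_add_pi, LinearMap.map_neg₂, hT.eq_one]
    exact hA.1

lemma monotoneOn (hT : IsSupport e θ T) :
    MonotoneOn (fun φ ↦ area e (circlePoint e φ) T) (Icc (θ - π) θ) := fun a ha b hb hab ↦ by
  have h := hT.sub_pi.antitoneOn (a := a) (b := b) (by simpa using ha) (by simpa using hb) hab
  simpa using h

lemma area_nonneg (hS : IsSupport e s S) (hT : IsSupport e t T) (hst : s < t)
    (hts : t < s + π) : 0 ≤ area e S T := by
  have hpos := area_circlePoint_pos (e := e) hst hts
  have key := area_mul_area (e := e) (circlePoint e s) (circlePoint e t) S T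
  rw [hS.eq_one, hT.eq_one] at key
  have hle : area e (circlePoint e s) T * area e (circlePoint e t) S ≤ 1 := by
    refine (le_abs_self _).trans ?_
    rw [abs_mul]
    exact mul_le_one₀ (hT.abs_area_circlePoint_le s) (abs_nonneg _) (hS.abs_area_circlePoint_le t)
  exact nonneg_of_mul_nonneg_right (key ▸ by linarith) hpos

lemma eq_of_area_eq_zero (hS : IsSupport e s S) (hT : IsSupport e t T) (h : area e S T = 0)
    (hd : ‖circlePoint e t - circlePoint e s‖ < 2) : S = T := by
  have hTS : T = area e (circlePoint e s) T • S := by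
    have := area_smul_eq (e := e) (circlePoint e s) S T
    rwa [hS.eq_one, one_smul, area_swap T S, h, neg_zero, zero_smul, zero_add] at this
  set κ := area e (circlePoint e s) T
  set μ := area e (circlePoint e t) S
  have hκμ : κ * μ = 1 := by
    rw [← hT.eq_one, hTS, map_smul, smul_eq_mul]
  have hκ : -1 < κ := by
    have := (hT.le_norm _).trans_lt hd
    rw [LinearMap.map_sub₂, hT.eq_one] at this
    linarith
  have hκ1 := abs_le.1 (hT.abs_area_circlePoint_le s)
  have hμ1 := abs_le.1 (hS.abs_area_circlePoint_le t)
  have hκ_eq : κ = 1 := by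
    rcases le_total κ 0 with h0 | h0 <;> nlinarith
  rw [hTS, hκ_eq, one_smul]

lemma exists_mem_Icc {φ : ℝ} (hS : IsSupport e s S) (hT : IsSupport e t T)
    (hV : IsSupport e φ V) (hst : s ≤ t) (hSV : 0 < area e S V) (hVT : 0 < area e V T)
    (hST : 0 < area e S T) : ∃ τ ∈ Icc s t, IsSupport e τ V := by
  wlog hφ : φ ∈ Ico s (s + 2 * π) generalizing φ
  · obtain ⟨n, hn⟩ := (existsUnique_add_zsmul_mem_Ico two_pi_pos φ s).exists
    exact this (hV.of_circlePoint_eq (circlePoint_periodic.zsmul n φ)) hn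
  have hmove : ∀ r, area e (circlePoint e φ) S ≤ area e (circlePoint e r) S →
      area e (circlePoint e φ) T ≤ area e (circlePoint e r) T → IsSupport e r V := by
    intro r h1 h2
    have eφ := area_mul_area_eq_add (e := e) S T (circlePoint e φ) V
    have er := area_mul_area_eq_add (e := e) S T (circlePoint e r) V
    have hle : area e S T * area e (circlePoint e φ) V ≤
        area e S T * area e (circlePoint e r) V := by
      rw [eφ, er]
      gcongr
    rw [mul_le_mul_iff_right₀ hST, hV.eq_one] at hle
    exact ⟨le_antisymm (abs_le.1 (hV.abs_area_circlePoint_le r)).2 hle, hV.le_norm⟩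
  rcases le_or_gt φ t with h1 | h1
  · exact ⟨φ, ⟨hφ.1, h1⟩, hV⟩
  rcases le_or_gt φ (s + π) with h2 | h2
  · exact ⟨t, right_mem_Icc.2 hst, hmove t
      (hS.antitoneOn ⟨hst, h1.le.trans h2⟩ ⟨hφ.1, h2⟩ h1.le)
      (hT.antitoneOn ⟨le_rfl, by linarith [pi_pos]⟩ ⟨h1.le, by linarith⟩ h1.le)⟩
  have hVS := hS.area_nonneg hV.sub_pi (by linarith) (by linarith [hφ.2])
  rw [map_neg] at hVS
  linarith

end IsSupport

/-- The linear functional with the values `‖S‖` at `S` and `‖T‖` at `T`. It is only meaningful for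
`area e S T ≠ 0`. -/
noncomputable def normInterp (e : ℂ ≃L[ℝ] E) (S T : E) : E →ₗ[ℝ] ℝ :=
  (‖S‖ / area e S T) • (area e).flip T - (‖T‖ / area e S T) • (area e).flip S

variable {S T V w : E}

lemma normInterp_apply (w : E) : normInterp e S T w =
    area e w T / area e S T * ‖S‖ + area e S w / area e S T * ‖T‖ := by
  rw [normInterp, area_swap S w]
  simp only [LinearMap.sub_apply, LinearMap.smul_apply, LinearMap.flip_apply, smul_eq_mul]
  ring

lemma normInterp_left (h : area e S T ≠ 0) : normInterp e S T S = ‖S‖ := by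
  rw [normInterp_apply, area_self, div_self h, zero_div, one_mul, zero_mul, add_zero]

lemma normInterp_right (h : area e S T ≠ 0) : normInterp e S T T = ‖T‖ := by
  rw [normInterp_apply, area_self, div_self h, zero_div, one_mul, zero_mul, zero_add]

lemma norm_le_normInterp (hST : 0 < area e S T) (hS : area e w S ≤ 0) (hT : 0 ≤ area e w T) :
    ‖w‖ ≤ normInterp e S T w := by
  have hα := div_nonneg hT hST.le
  have hβ : 0 ≤ area e S w / area e S T := div_nonneg (by rw [area_swap]; linarith) hST.le
  rw [normInterp_apply]
  calc ‖w‖ = ‖(area e w T / area e S T) • S + (area e S w / area e S T) • T‖ :=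
        congrArg norm (eq_smul_add_smul_of_area_ne_zero hST.ne' w)
    _ ≤ _ := by
        simpa only [norm_smul, Real.norm_of_nonneg hα, Real.norm_of_nonneg hβ] using
          norm_add_le ((area e w T / area e S T) • S) ((area e S w / area e S T) • T)

lemma normInterp_le_norm (hST : 0 < area e S T) (hw : 0 ≤ area e w S ∨ area e w T ≤ 0) :
    normInterp e S T w ≤ ‖w‖ := by
  rw [normInterp_apply]
  conv_rhs => rw [eq_smul_add_smul_of_area_ne_zero hST.ne' w]
  rcases hw with hw | hw
  · rw [add_comm, add_comm (_ • S)]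
    refine mul_norm_add_mul_norm_le_norm_smul_add_smul ?_ _ _ _
    exact div_nonpos_of_nonpos_of_nonneg (by rw [area_swap]; linarith) hST.le
  · exact mul_norm_add_mul_norm_le_norm_smul_add_smul
      (div_nonpos_of_nonpos_of_nonneg hw hST.le) _ _ _

lemma normInterp_le_normInterp (hSV : 0 < area e S V) (hVT : 0 < area e V T)
    (hw : 0 ≤ area e w V) : normInterp e V T w ≤ normInterp e S V w := by
  have hS : normInterp e V T S ≤ ‖S‖ := normInterp_le_norm hVT (Or.inl hSV.le)
  have hw_eq := area_smul_eq (e := e) S V w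
  have hl := congrArg (normInterp e V T) hw_eq
  have hr := congrArg (normInterp e S V) hw_eq
  simp only [map_add, map_smul, smul_eq_mul, normInterp_left hVT.ne', normInterp_left hSV.ne',
    normInterp_right hSV.ne'] at hl hr
  refine le_of_mul_le_mul_left ?_ hSV
  rw [hl, hr]
  gcongr

end Support

section ArcLength

variable {E : Type*} [NormedAddCommGroup E] [NormedSpace ℝ E] (e : ℂ ≃L[ℝ] E)

/-- The signed length of the arc of the unit circle from `circlePoint e s` counterclockwise to
`circlePoint e t`; it is negative for `t < s`. -/
noncomputable def arcLength (s t : ℝ) : ℝ := variationOnFromTo (circlePoint e) univ s t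

variable {e} {s t : ℝ}

lemma locallyBoundedVariationOn_circlePoint :
    LocallyBoundedVariationOn (circlePoint e) univ :=
  exists_lipschitzWith_circlePoint.choose_spec.locallyBoundedVariationOn univ

lemma arcLength_add (r s t : ℝ) : arcLength e r s + arcLength e s t = arcLength e r t :=
  variationOnFromTo.add locallyBoundedVariationOn_circlePoint trivial trivial trivial

lemma arcLength_self (s : ℝ) : arcLength e s s = 0 :=
  variationOnFromTo.self _ _ s

lemma arcLength_nonneg (hst : s ≤ t) : 0 ≤ arcLength e s t :=
  variationOnFromTo.nonneg_of_le _ _ hst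

lemma arcLength_eq_sub (s t : ℝ) : arcLength e s t = arcLength e 0 t - arcLength e 0 s := by
  rw [← arcLength_add 0 s t, add_sub_cancel_left]

lemma eVariationOn_circlePoint_Icc (hst : s ≤ t) :
    eVariationOn (circlePoint e) (Icc s t) = ENNReal.ofReal (arcLength e s t) := by
  rw [arcLength, variationOnFromTo.eq_of_le _ _ hst, ENNReal.ofReal_toReal
    (locallyBoundedVariationOn_circlePoint s t trivial trivial), univ_inter]

lemma norm_sub_le_arcLength (hst : s ≤ t) :
    ‖circlePoint e t - circlePoint e s‖ ≤ arcLength e s t := by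
  rw [← ENNReal.ofReal_le_ofReal_iff (arcLength_nonneg hst), ← eVariationOn_circlePoint_Icc hst,
    ← dist_eq_norm, ← edist_dist]
  exact eVariationOn.edist_le _ (right_mem_Icc.2 hst) (left_mem_Icc.2 hst)

lemma arcLength_le_sub {g : ℝ → ℝ} (hst : s ≤ t) (h : ∀ a b, s ≤ a → a ≤ b → b ≤ t →
      ‖circlePoint e b - circlePoint e a‖ ≤ g b - g a) :
    arcLength e s t ≤ g t - g s := by
  rw [← ENNReal.ofReal_le_ofReal_iff ((norm_nonneg _).trans (h s t le_rfl hst le_rfl)),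
    ← eVariationOn_circlePoint_Icc hst]
  exact eVariationOn_Icc_le_ofReal_sub fun a b ha hab hb ↦
    (dist_eq_norm' _ _).trans_le (h a b ha hab hb)

lemma continuous_arcLength : Continuous fun p : ℝ × ℝ ↦ arcLength e p.1 p.2 := by
  obtain ⟨K, hK⟩ := exists_lipschitzWith_circlePoint (e := e)
  have hle : ∀ a b, a ≤ b → arcLength e a b ≤ K * (b - a) := fun a b hab ↦ by
    have := arcLength_le_sub (e := e) (g := fun θ ↦ K * θ) hab fun a' b' _ h _ ↦ by
      have := hK.dist_le_mul b' a'
      rwa [dist_eq_norm, Real.dist_eq, abs_of_nonneg (sub_nonneg.2 h), mul_sub] at this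
    rwa [mul_sub]
  have hlip : LipschitzWith K (arcLength e 0) := LipschitzWith.of_le_add_mul K fun a b ↦ by
    have hab := arcLength_add (e := e) 0 b a
    rcases le_total a b with h | h
    · have := arcLength_add (e := e) 0 a b
      have := arcLength_nonneg (e := e) h
      have : 0 ≤ K * dist a b := by positivity
      linarith
    · have := hle b a h
      rw [Real.dist_eq, abs_of_nonneg (sub_nonneg.2 h)]
      linarith
  simp only [arcLength_eq_sub (e := e) (_ : ℝ × ℝ).1]
  exact (hlip.continuous.comp continuous_snd).sub (hlip.continuous.comp continuous_fst)

lemma arcLength_add_pi (s t : ℝ) : arcLength e (s + π) (t + π) = arcLength e s t := by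
  have himage : (· + π) '' (univ : Set ℝ) = univ :=
    image_univ_of_surjective (add_right_surjective π)
  have hcomp : circlePoint e ∘ (· + π) = -circlePoint e := funext circlePoint_add_pi
  have h := variationOnFromTo.comp_eq_of_monotoneOn (circlePoint e) (t := univ) (· + π)
    ((add_left_mono (a := π)).monotoneOn _) (mem_univ s) (mem_univ t)
  rw [himage, hcomp] at h
  rw [arcLength, ← h]
  simp only [arcLength, variationOnFromTo, eVariationOn, Pi.neg_apply, edist_neg_neg]

lemma arcLength_add_two_pi (s t : ℝ) :
    arcLength e (s + 2 * π) (t + 2 * π) = arcLength e s t := by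
  rw [two_mul, ← add_assoc, ← add_assoc, arcLength_add_pi, arcLength_add_pi]

lemma arcLength_add_zsmul (s t : ℝ) (n : ℤ) :
    arcLength e (s + n • (2 * π)) (t + n • (2 * π)) = arcLength e s t := by
  have h : Function.Periodic (fun r ↦ arcLength e (s + r) (t + r)) (2 * π) := fun r ↦ by
    beta_reduce
    rw [← add_assoc, ← add_assoc, arcLength_add_two_pi]
  simpa using h.zsmul n 0

end ArcLength

section ArcFunctional

variable {E : Type*} [NormedAddCommGroup E] [NormedSpace ℝ E] (e : ℂ ≃L[ℝ] E)

/-- The length of the arc of the unit circle up to `circlePoint e θ`, minus the linear functional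
`u` at its endpoint. -/
noncomputable def lengthExcess (u : E →ₗ[ℝ] ℝ) (θ : ℝ) : ℝ :=
  arcLength e 0 θ - u (circlePoint e θ)

/-- `u` grows at least as fast as the length along the arc of the unit circle from `s` to `t`, and
at most as fast along the complementary arc. It is a subgradient of the length of an arc with
respect to its chord. -/
structure IsArcFunctional (s t : ℝ) (u : E →ₗ[ℝ] ℝ) : Prop where
  antitoneOn : AntitoneOn (lengthExcess e u) (Icc s t)
  monotoneOn : MonotoneOn (lengthExcess e u) (Icc t (s + 2 * π))

variable {e} {s t : ℝ} {u : E →ₗ[ℝ] ℝ} {S T V : E}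

lemma lengthExcess_sub (a b : ℝ) : lengthExcess e u b - lengthExcess e u a =
    arcLength e a b - u (circlePoint e b - circlePoint e a) := by
  rw [lengthExcess, lengthExcess, arcLength_eq_sub a b, map_sub]
  ring

lemma lengthExcess_add_two_pi (θ : ℝ) :
    lengthExcess e u (θ + 2 * π) = lengthExcess e u θ + arcLength e 0 (2 * π) := by
  have h := arcLength_add_two_pi (e := e) 0 θ
  rw [lengthExcess, lengthExcess, circlePoint_periodic, ← arcLength_add 0 (2 * π) (θ + 2 * π)]
  rw [zero_add] at h
  linarith

lemma antitoneOn_lengthExcess (h : ∀ a b, s ≤ a → a ≤ b → b ≤ t →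
      ‖circlePoint e b - circlePoint e a‖ ≤ u (circlePoint e b - circlePoint e a)) :
    AntitoneOn (lengthExcess e u) (Icc s t) := fun a ha b hb hab ↦ by
  rw [← sub_nonpos, lengthExcess_sub, sub_nonpos, map_sub]
  refine arcLength_le_sub (g := fun θ ↦ u (circlePoint e θ)) hab fun x y hx hxy hy ↦ ?_
  rw [← map_sub]
  exact h x y (ha.1.trans hx) hxy (hy.trans hb.2)

lemma monotoneOn_lengthExcess (h : ∀ a b, s ≤ a → a ≤ b → b ≤ t →
      u (circlePoint e b - circlePoint e a) ≤ ‖circlePoint e b - circlePoint e a‖) :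
    MonotoneOn (lengthExcess e u) (Icc s t) := fun a ha b hb hab ↦ by
  rw [← sub_nonneg, lengthExcess_sub, sub_nonneg]
  exact (h a b ha.1 hab hb.2).trans (norm_sub_le_arcLength hab)

lemma IsArcFunctional.le_arcLength (hu : IsArcFunctional e s t u) (hst : s ≤ t)
    (hts : t ≤ s + 2 * π) {a b : ℝ} (hab : a ≤ b) (hba : b ≤ a + 2 * π) :
    arcLength e s t + u ((circlePoint e b - circlePoint e a) -
      (circlePoint e t - circlePoint e s)) ≤ arcLength e a b := by
  wlog ha : a ∈ Ico s (s + 2 * π) generalizing a b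
  · obtain ⟨n, hn⟩ := (existsUnique_add_zsmul_mem_Ico two_pi_pos a s).exists
    have h := this (b := b + n • (2 * π)) (by linarith) (by linarith) hn
    rwa [arcLength_add_zsmul, circlePoint_periodic.zsmul, circlePoint_periodic.zsmul] at h
  have hP : 0 ≤ arcLength e 0 (2 * π) := arcLength_nonneg two_pi_pos.le
  have hs := lengthExcess_add_two_pi (e := e) (u := u) s
  have hmin : ∀ c ∈ Icc s (s + 2 * π), lengthExcess e u t ≤ lengthExcess e u c := fun c hc ↦ by
    rcases le_total c t with h | h
    · exact hu.antitoneOn ⟨hc.1, h⟩ ⟨hst, le_rfl⟩ h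
    · exact hu.monotoneOn ⟨le_rfl, hts⟩ ⟨h, hc.2⟩ h
  have hwrap : s + 2 * π ≤ b → lengthExcess e u t + arcLength e 0 (2 * π) ≤ lengthExcess e u b :=
    fun h ↦ by
    have hb := lengthExcess_add_two_pi (e := e) (u := u) (b - 2 * π)
    rw [sub_add_cancel] at hb
    linarith [hmin (b - 2 * π) ⟨by linarith, by linarith [ha.2]⟩]
  suffices h : lengthExcess e u t - lengthExcess e u s ≤
      lengthExcess e u b - lengthExcess e u a by
    rw [lengthExcess_sub, lengthExcess_sub] at h
    rw [map_sub u (_ - _)]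
    linarith
  rcases le_total a t with hat | hat
  · have := hu.antitoneOn ⟨le_rfl, hst⟩ ⟨ha.1, hat⟩ ha.1
    rcases le_total b (s + 2 * π) with hb | hb
    · linarith [hmin b ⟨ha.1.trans hab, hb⟩]
    · linarith [hwrap hb]
  · rcases le_total b (s + 2 * π) with hb | hb
    · linarith [hu.monotoneOn ⟨hat, ha.2.le⟩ ⟨hat.trans hab, hb⟩ hab, hmin s ⟨le_rfl, by linarith⟩]
    · linarith [hu.monotoneOn ⟨hat, ha.2.le⟩ ⟨hts, le_rfl⟩ ha.2.le, hwrap hb]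

namespace IsSupport

lemma isArcFunctional_normInterp (hS : IsSupport e s S) (hT : IsSupport e t T) (hst : s ≤ t)
    (hts : t ≤ s + π) (hST : 0 < area e S T) : IsArcFunctional e s t (normInterp e S T) where
  antitoneOn := antitoneOn_lengthExcess fun a b ha hab hb ↦ by
    refine norm_le_normInterp hST ?_ ?_ <;> rw [LinearMap.map_sub₂]
    · exact sub_nonpos.2
        (hS.antitoneOn ⟨ha, (hab.trans hb).trans hts⟩ ⟨ha.trans hab, hb.trans hts⟩ hab)
    · exact sub_nonneg.2 (hT.monotoneOn ⟨by linarith, hab.trans hb⟩ ⟨by linarith, hb⟩ hab)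
  monotoneOn := by
    have hleft : MonotoneOn (lengthExcess e (normInterp e S T)) (Icc t (s + π)) :=
      monotoneOn_lengthExcess fun a b ha hab hb ↦ normInterp_le_norm hST <| .inr <| by
        rw [LinearMap.map_sub₂]
        exact sub_nonpos.2 (hT.antitoneOn ⟨ha, by linarith⟩ ⟨ha.trans hab, by linarith⟩ hab)
    have hright : MonotoneOn (lengthExcess e (normInterp e S T)) (Icc (s + π) (s + 2 * π)) :=
      monotoneOn_lengthExcess fun a b ha hab hb ↦ normInterp_le_norm hST <| .inl <| by
        rw [LinearMap.map_sub₂]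
        exact sub_nonneg.2 (hS.add_two_pi.monotoneOn ⟨by linarith, hab.trans hb⟩
          ⟨by linarith, hb⟩ hab)
    rw [← Icc_union_Icc_eq_Icc hts (by linarith [pi_pos] : s + π ≤ s + 2 * π)]
    exact hleft.union_right hright (isGreatest_Icc hts) (isLeast_Icc (by linarith [pi_pos]))

lemma area_circlePoint_eq_one (hS : IsSupport e s T) (hT : IsSupport e t T) (hts : t ≤ s + π)
    {a : ℝ} (ha : a ∈ Icc s t) : area e (circlePoint e a) T = 1 := by
  refine le_antisymm (abs_le.1 (hT.abs_area_circlePoint_le a)).2 ?_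
  rw [← hT.eq_one]
  exact hS.antitoneOn ⟨ha.1, ha.2.trans hts⟩ ⟨ha.1.trans ha.2, hts⟩ ha.2

lemma exists_isArcFunctional_of_eq (hS : IsSupport e s T) (hT : IsSupport e t T)
    (hts : t ≤ s + π) : ∃ u, IsArcFunctional e s t u ∧ ∀ w, u w ≤ ‖w‖ := by
  obtain ⟨V, hV, hle⟩ := exists_area_eq_norm (e := e) T
  refine ⟨(area e).flip V, ⟨antitoneOn_lengthExcess fun a b ha hab hb ↦ ?_,
    monotoneOn_lengthExcess fun _ _ _ _ _ ↦ hle _⟩, hle⟩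
  have hA := hS.area_circlePoint_eq_one hT hts ⟨ha, hab.trans hb⟩
  have hB := hS.area_circlePoint_eq_one hT hts ⟨ha.trans hab, hb⟩
  have hab0 := area_circlePoint_nonneg (e := e) hab (by linarith)
  have hchord : circlePoint e b - circlePoint e a =
      area e (circlePoint e a) (circlePoint e b) • T := by
    have h := area_smul_eq (e := e) (circlePoint e a) T (circlePoint e b - circlePoint e a)
    rwa [hA, LinearMap.map_sub₂, hA, hB, sub_self, map_sub, area_self, sub_zero, one_smul,
      zero_smul, zero_add] at h
  rw [LinearMap.flip_apply, hchord, LinearMap.map_smul₂, hV, norm_smul, norm_of_nonneg hab0,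
    smul_eq_mul]

end IsSupport

end ArcFunctional

section Chord

variable {E : Type*} [NormedAddCommGroup E] [NormedSpace ℝ E] (e : ℂ ≃L[ℝ] E)

/-- The arc of the unit circle from `circlePoint e s` counterclockwise to `circlePoint e t` is at
most half a turn long and has the chord vector `d`. -/
structure IsChord (d : E) (s t : ℝ) : Prop where
  le : s ≤ t
  le_add_pi : t ≤ s + π
  sub_eq : circlePoint e t - circlePoint e s = d

variable {e} {d : E} {s t : ℝ}

namespace IsChord

lemma norm_le_two (h : IsChord e d s t) : ‖d‖ ≤ 2 := by
  rw [← h.sub_eq]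
  refine (norm_sub_le _ _).trans_eq ?_
  rw [norm_circlePoint, norm_circlePoint, one_add_one_eq_two]

lemma lt_add_pi (h : IsChord e d s t) (hd : ‖d‖ < 2) : t < s + π := by
  refine h.le_add_pi.lt_of_ne fun hts ↦ hd.ne ?_
  rw [← h.sub_eq, hts, circlePoint_add_pi, ← neg_add', norm_neg, ← two_smul ℝ, norm_smul,
    norm_circlePoint, norm_two, mul_one]

lemma add_zsmul (h : IsChord e d s t) (n : ℤ) :
    IsChord e d (s + n • (2 * π)) (t + n • (2 * π)) where
  le := by linarith [h.le]
  le_add_pi := by linarith [h.le_add_pi]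
  sub_eq := by rw [circlePoint_periodic.zsmul, circlePoint_periodic.zsmul, h.sub_eq]

lemma neg (h : IsChord e d s t) : IsChord e (-d) (s + π) (t + π) where
  le := by linarith [h.le]
  le_add_pi := by linarith [h.le_add_pi]
  sub_eq := by rw [circlePoint_add_pi, circlePoint_add_pi, ← h.sub_eq, neg_sub_neg, neg_sub]

lemma exists_isArcFunctional (h : IsChord e d s t) (hd : ‖d‖ < 2) :
    ∃ u, IsArcFunctional e s t u := by
  obtain ⟨S, hS⟩ := exists_isSupport (e := e) s
  rcases h.le.eq_or_lt with rfl | hlt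
  · exact (hS.exists_isArcFunctional_of_eq hS (by linarith [pi_pos])).imp fun _ ↦ And.left
  obtain ⟨T, hT⟩ := exists_isSupport (e := e) t
  rcases (hS.area_nonneg hT hlt (h.lt_add_pi hd)).lt_or_eq with hpos | hzero
  · exact ⟨_, hS.isArcFunctional_normInterp hT h.le h.le_add_pi hpos⟩
  · obtain rfl := hS.eq_of_area_eq_zero hT hzero.symm (h.sub_eq ▸ hd)
    exact (hS.exists_isArcFunctional_of_eq hT h.le_add_pi).imp fun _ ↦ And.left

end IsChord

-- An arc longer than half a turn shares its chord with the antipode of the complementary arc.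
lemma isChord_of_pi_le (h : s + π ≤ t) (h' : t ≤ s + 2 * π) :
    IsChord e (circlePoint e t - circlePoint e s) (t - π) (s + π) where
  le := by linarith
  le_add_pi := by linarith
  sub_eq := by rw [circlePoint_add_pi, circlePoint_sub_pi, neg_sub_neg]

lemma exists_isChord (hd : ‖d‖ ≤ 2) : ∃ s t, IsChord e d s t := by
  obtain ⟨θ, -, hθ⟩ := exists_eq_norm_smul_circlePoint (e := e) d 0
  have hnorm : ∀ φ k, circlePoint e φ + d = k • circlePoint e θ → ‖circlePoint e φ + d‖ = |k| :=
    fun φ k h ↦ by rw [h, norm_smul, norm_circlePoint, mul_one, norm_eq_abs]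
  have hfar : 1 ≤ ‖circlePoint e θ + d‖ := by
    rw [hnorm θ (1 + ‖d‖) (by rw [add_smul, one_smul, ← hθ])]
    exact le_abs.2 (.inl (le_add_of_nonneg_right (norm_nonneg d)))
  have hnear : ‖circlePoint e (θ + π) + d‖ ≤ 1 := by
    rw [hnorm (θ + π) (‖d‖ - 1) (by
      rw [sub_smul, one_smul, ← hθ, circlePoint_add_pi, neg_add_eq_sub])]
    exact abs_le.2 ⟨by linarith [norm_nonneg d], by linarith⟩
  obtain ⟨s, hs⟩ := mem_range_of_exists_le_of_exists_ge
    (f := fun s ↦ ‖circlePoint e s + d‖) ((continuous_circlePoint.add continuous_const).norm)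
    ⟨_, hnear⟩ ⟨_, hfar⟩
  obtain ⟨t, ht, hte⟩ := exists_eq_norm_smul_circlePoint (e := e) (circlePoint e s + d) s
  rw [show ‖circlePoint e s + d‖ = 1 from hs, one_smul] at hte
  have hd' : circlePoint e t - circlePoint e s = d := by rw [← hte, add_sub_cancel_left]
  rcases le_total t (s + π) with h | h
  · exact ⟨s, t, ht.1, h, hd'⟩
  · exact ⟨t - π, s + π, hd' ▸ isChord_of_pi_le h ht.2.le⟩

end Chord

section MinArcLength

variable {E : Type*} [NormedAddCommGroup E] [NormedSpace ℝ E] (e : ℂ ≃L[ℝ] E)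

/-- The length of the shortest arc of the unit circle with the chord vector `d`; it is only
meaningful for `‖d‖ ≤ 2`, since longer vectors are not chords. -/
noncomputable def minArcLength (d : E) : ℝ :=
  sInf {l | ∃ s t, IsChord e d s t ∧ arcLength e s t = l}

variable {e} {c d : E} {r s t B : ℝ} {u : E →ₗ[ℝ] ℝ}

lemma IsChord.minArcLength_le (h : IsChord e d s t) : minArcLength e d ≤ arcLength e s t :=
  csInf_le ⟨0, by rintro _ ⟨a, b, hab, rfl⟩; exact arcLength_nonneg hab.le⟩ ⟨s, t, h, rfl⟩

lemma minArcLength_nonneg (d : E) : 0 ≤ minArcLength e d :=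
  Real.sInf_nonneg (by rintro _ ⟨s, t, h, rfl⟩; exact arcLength_nonneg h.le)

lemma minArcLength_neg (d : E) : minArcLength e (-d) = minArcLength e d := by
  have key : ∀ c : E, {l | ∃ s t, IsChord e c s t ∧ arcLength e s t = l} ⊆
      {l | ∃ s t, IsChord e (-c) s t ∧ arcLength e s t = l} := by
    rintro c _ ⟨s, t, h, rfl⟩
    exact ⟨_, _, h.neg, arcLength_add_pi s t⟩
  exact congrArg sInf (Subset.antisymm (by simpa using key (-d)) (key d))

lemma minArcLength_zero : minArcLength e 0 = 0 := by
  have h : IsChord e 0 0 0 := ⟨le_rfl, by linarith [pi_pos], sub_self _⟩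
  exact le_antisymm (h.minArcLength_le.trans_eq (arcLength_self 0)) (minArcLength_nonneg 0)

lemma IsChord.exists_mem_Icc (h : IsChord e d s t) : ∃ s' t', s' ∈ Icc 0 (2 * π) ∧
    IsChord e d s' t' ∧ arcLength e s' t' = arcLength e s t := by
  obtain ⟨n, hn⟩ := (existsUnique_add_zsmul_mem_Ico two_pi_pos s 0).exists
  rw [zero_add] at hn
  exact ⟨_, _, Ico_subset_Icc_self hn, h.add_zsmul n, arcLength_add_zsmul s t n⟩

lemma isCompact_setOf_arc :
    IsCompact {p : ℝ × ℝ | p.1 ∈ Icc 0 (2 * π) ∧ p.1 ≤ p.2 ∧ p.2 ≤ p.1 + π} := by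
  refine (isCompact_Icc.prod isCompact_Icc : IsCompact
    (Icc (0 : ℝ) (2 * π) ×ˢ Icc (0 : ℝ) (3 * π))).of_isClosed_subset ?_ ?_
  · exact (isClosed_Icc.preimage continuous_fst).inter <|
      (isClosed_le continuous_fst continuous_snd).inter <|
      isClosed_le continuous_snd (continuous_fst.add continuous_const)
  · rintro ⟨s, t⟩ ⟨hs, h1, h2⟩
    exact ⟨hs, hs.1.trans h1, h2.trans (by linarith [hs.2])⟩

lemma continuous_circlePoint_sub :
    Continuous fun p : ℝ × ℝ ↦ circlePoint e p.2 - circlePoint e p.1 :=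
  (continuous_circlePoint.comp continuous_snd).sub (continuous_circlePoint.comp continuous_fst)

lemma exists_isChord_arcLength_eq_minArcLength (hd : ‖d‖ ≤ 2) :
    ∃ s t, IsChord e d s t ∧ arcLength e s t = minArcLength e d := by
  obtain ⟨s₀, t₀, h₀⟩ := exists_isChord (e := e) hd
  obtain ⟨s₁, t₁, hs₁, h₁, -⟩ := h₀.exists_mem_Icc
  obtain ⟨⟨s, t⟩, ⟨⟨-, hle, hle'⟩, heq⟩, hmin⟩ :=
    (isCompact_setOf_arc.inter_right (isClosed_singleton (x := d).preimage
      (continuous_circlePoint_sub (e := e)))).exists_isMinOn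
      ⟨(s₁, t₁), ⟨hs₁, h₁.le, h₁.le_add_pi⟩, h₁.sub_eq⟩
      (continuous_arcLength (e := e)).continuousOn
  have h : IsChord e d s t := ⟨hle, hle', heq⟩
  refine ⟨s, t, h, le_antisymm (le_csInf ⟨_, s, t, h, rfl⟩ ?_) h.minArcLength_le⟩
  rintro _ ⟨a, b, hab, rfl⟩
  obtain ⟨a', b', ha', hab', hl⟩ := hab.exists_mem_Icc
  rw [← hl]
  exact hmin (a := (a', b')) ⟨⟨ha', hab'.le, hab'.le_add_pi⟩, hab'.sub_eq⟩

lemma isClosed_setOf_minArcLength_le (B : ℝ) :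
    IsClosed {d : E | ‖d‖ ≤ 2 ∧ minArcLength e d ≤ B} := by
  convert ((isCompact_setOf_arc.inter_right (isClosed_Iic (a := B).preimage
    (continuous_arcLength (e := e)))).image (continuous_circlePoint_sub (e := e))).isClosed using 1
  ext d
  constructor
  · rintro ⟨hd, hB⟩
    obtain ⟨s₀, t₀, h₀, hmin⟩ := exists_isChord_arcLength_eq_minArcLength (e := e) hd
    obtain ⟨s, t, hs, h, hl⟩ := h₀.exists_mem_Icc
    exact ⟨(s, t), ⟨⟨hs, h.le, h.le_add_pi⟩, (hl.trans hmin).trans_le hB⟩, h.sub_eq⟩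
  · rintro ⟨⟨s, t⟩, ⟨⟨-, h1, h2⟩, hB⟩, rfl⟩
    have h : IsChord e (circlePoint e t - circlePoint e s) s t := ⟨h1, h2, rfl⟩
    exact ⟨h.norm_le_two, h.minArcLength_le.trans hB⟩

lemma minArcLength_le_of_forall_smul_le (hd : ‖d‖ ≤ 2)
    (h : ∀ r ∈ Ico (0 : ℝ) 1, minArcLength e (r • d) ≤ B) : minArcLength e d ≤ B := by
  have hlim : Tendsto (fun r : ℝ ↦ r • d) (𝓝[<] 1) (𝓝 d) := by
    refine ((continuous_id.smul continuous_const).tendsto' 1 d ?_).mono_left nhdsWithin_le_nhds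
    exact one_smul ℝ d
  refine ((isClosed_setOf_minArcLength_le B).mem_of_tendsto hlim ?_).2
  filter_upwards [Ico_mem_nhdsLT one_pos] with r hr
  refine ⟨?_, h r hr⟩
  rw [norm_smul, norm_of_nonneg hr.1]
  exact (mul_le_of_le_one_left (norm_nonneg d) hr.2.le).trans hd

lemma norm_le_minArcLength (hd : ‖d‖ ≤ 2) : ‖d‖ ≤ minArcLength e d := by
  obtain ⟨s, t, h, hmin⟩ := exists_isChord_arcLength_eq_minArcLength (e := e) hd
  rw [← hmin, ← h.sub_eq]
  exact norm_sub_le_arcLength h.le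

lemma minArcLength_le_arcLength (hst : s ≤ t) :
    minArcLength e (circlePoint e t - circlePoint e s) ≤ arcLength e s t := by
  obtain ⟨n, hn, -⟩ := existsUnique_sub_zsmul_mem_Ico two_pi_pos t s
  have hsub (a b : ℝ) (ha : s ≤ a) (hb : b ≤ t) : arcLength e a b ≤ arcLength e s t := by
    rw [← arcLength_add s a t, ← arcLength_add a b t]
    linarith [arcLength_nonneg (e := e) ha, arcLength_nonneg (e := e) hb]
  rw [← circlePoint_periodic.sub_zsmul_eq n (x := t)]
  have hn0 : -1 < n := by
    have h : -1 * (2 * π) < n * (2 * π) := by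
      rw [← zsmul_eq_mul]
      linarith [hn.2]
    exact_mod_cast lt_of_mul_lt_mul_right h two_pi_pos.le
  have hle : t - n • (2 * π) ≤ t := sub_le_self t (zsmul_nonneg two_pi_pos.le (by lia))
  generalize t - n • (2 * π) = t' at hn hle
  rcases le_total t' (s + π) with h | h
  · exact (IsChord.minArcLength_le ⟨hn.1, h, rfl⟩).trans (hsub s t' le_rfl hle)
  · exact (isChord_of_pi_le h hn.2.le).minArcLength_le.trans
      (hsub _ _ (by linarith) (h.trans hle))

lemma IsArcFunctional.le_minArcLength (hu : IsArcFunctional e s t u) (hst : s ≤ t)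
    (hts : t ≤ s + 2 * π) (hd : ‖d‖ ≤ 2) :
    arcLength e s t + u (d - (circlePoint e t - circlePoint e s)) ≤ minArcLength e d := by
  obtain ⟨a, b, h, hmin⟩ := exists_isChord_arcLength_eq_minArcLength (e := e) hd
  rw [← hmin, ← h.sub_eq]
  exact hu.le_arcLength hst hts h.le (by linarith [h.le_add_pi, pi_pos])

lemma exists_subgradient_minArcLength (hd : ‖d‖ < 2) :
    ∃ u : E →ₗ[ℝ] ℝ, ∀ c, ‖c‖ ≤ 2 → minArcLength e d + u (c - d) ≤ minArcLength e c := by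
  obtain ⟨s, t, h, hmin⟩ := exists_isChord_arcLength_eq_minArcLength (e := e) hd.le
  obtain ⟨u, hu⟩ := h.exists_isArcFunctional hd
  refine ⟨u, fun c hc ↦ ?_⟩
  rw [← hmin, ← h.sub_eq]
  exact hu.le_minArcLength h.le (by linarith [h.le_add_pi, pi_pos]) hc

lemma norm_smul_lt_two (hd : ‖d‖ ≤ 2) (hr : r ∈ Ico (0 : ℝ) 1) : ‖r • d‖ < 2 := by
  rw [norm_smul, norm_of_nonneg hr.1]
  nlinarith [norm_nonneg d, hr.1, hr.2]

lemma minArcLength_smul_le (hd : ‖d‖ ≤ 2) (hr : r ∈ Icc (0 : ℝ) 1) :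
    minArcLength e (r • d) ≤ r * minArcLength e d := by
  rcases hr.2.eq_or_lt with rfl | hr1
  · rw [one_smul, one_mul]
  obtain ⟨u, hu⟩ := exists_subgradient_minArcLength (e := e) (norm_smul_lt_two hd ⟨hr.1, hr1⟩)
  have h0 := hu 0 (norm_zero.trans_le zero_le_two)
  have h1 := hu d hd
  rw [minArcLength_zero, zero_sub, map_neg, map_smul, smul_eq_mul] at h0
  rw [map_sub, map_smul, smul_eq_mul] at h1
  calc minArcLength e (r • d) = (1 - r) * (minArcLength e (r • d) + -(r * u d)) +
        r * (minArcLength e (r • d) + (u d - r * u d)) := by ring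
    _ ≤ (1 - r) * 0 + r * minArcLength e d := by
        gcongr
        exact hr.1
    _ = r * minArcLength e d := by ring

theorem convexOn_minArcLength : ConvexOn ℝ (closedBall 0 2) (minArcLength e) := by
  refine ⟨convex_closedBall 0 2, fun x hx y hy a b ha hb hab ↦ ?_⟩
  have hm := mem_closedBall_zero_iff.1 (convex_closedBall (0 : E) 2 hx hy ha hb hab)
  rw [mem_closedBall_zero_iff] at hx hy
  refine minArcLength_le_of_forall_smul_le hm fun r hr ↦ ?_
  obtain ⟨u, hu⟩ := exists_subgradient_minArcLength (e := e) (norm_smul_lt_two hm hr)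
  have hle : ∀ w, ‖w‖ ≤ 2 → minArcLength e (r • (a • x + b • y)) +
      u (r • w - r • (a • x + b • y)) ≤ minArcLength e w := fun w hw ↦
    (hu _ (norm_smul_lt_two hw hr).le).trans <|
      (minArcLength_smul_le hw (Ico_subset_Icc_self hr)).trans <|
      mul_le_of_le_one_left (minArcLength_nonneg w) hr.2.le
  have hx' := mul_le_mul_of_nonneg_left (hle x hx) ha
  have hy' := mul_le_mul_of_nonneg_left (hle y hy) hb
  obtain rfl : b = 1 - a := by linarith
  simp only [smul_eq_mul, map_sub, map_smul, map_add] at hx' hy' ⊢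
  linarith

end MinArcLength

section UnitSpindle

variable {E : Type*} [NormedAddCommGroup E]

/-- The spindle of `x` and `z` with respect to the unit ball: the points lying in every closed
ball of radius one that contains `x` and `z`. -/
def unitSpindle (x z : E) : Set E :=
  {y | ∀ v, x ∈ closedBall v 1 → z ∈ closedBall v 1 → y ∈ closedBall v 1}

variable {x y z : E}

lemma unitSpindle_comm (x z : E) : unitSpindle x z = unitSpindle z x :=
  Set.ext fun _ ↦ forall_congr' fun _ ↦ forall_comm

lemma exists_one_le_norm_sub_of_notMem_interior_unitSpindle [ProperSpace E]
    (hy : y ∉ interior (unitSpindle x z)) :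
    ∃ v, x ∈ closedBall v 1 ∧ z ∈ closedBall v 1 ∧ 1 ≤ ‖y - v‖ := by
  by_contra! hlt
  refine hy (mem_interior_iff_mem_nhds.2 ?_)
  have hK : IsCompact (closedBall x 1 ∩ closedBall z 1) :=
    (isCompact_closedBall x 1).inter_right isClosed_closedBall
  have hnear : ∀ᶠ w in 𝓝 y, ∀ v ∈ closedBall x 1 ∩ closedBall z 1, ‖w - v‖ < 1 := by
    refine hK.eventually_forall_of_forall_eventually fun v hv ↦ ?_
    refine (continuous_fst.sub continuous_snd).norm.continuousAt.eventually_lt continuousAt_const ?_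
    exact hlt v (mem_closedBall_comm.1 hv.1) (mem_closedBall_comm.1 hv.2)
  filter_upwards [hnear] with w hw v hx hz
  exact mem_closedBall_iff_norm.2
    (hw v ⟨mem_closedBall_comm.1 hx, mem_closedBall_comm.1 hz⟩).le

variable [NormedSpace ℝ E] {e : ℂ ≃L[ℝ] E} {d n : E} {s t θ k l r : ℝ}

lemma nonpos_of_add_smul_mem_unitSpindle (hn : ‖n‖ = 1) (hzx : z - x = l • n)
    (hl : l ∈ Icc (0 : ℝ) 2) (h : z + k • n ∈ unitSpindle x z) : k ≤ 0 := by
  have hnorm : ∀ a : ℝ, ‖a • n‖ = |a| := fun a ↦ by rw [norm_smul, hn, mul_one, norm_eq_abs]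
  have hx : x ∈ closedBall (z - n) 1 := by
    rw [mem_closedBall_iff_norm, show x - (z - n) = (1 - l) • n by
      rw [sub_smul, one_smul, ← hzx]; abel, hnorm]
    exact abs_le.2 ⟨by linarith [hl.2], by linarith [hl.1]⟩
  have hz : z ∈ closedBall (z - n) 1 := by
    rw [mem_closedBall_iff_norm, sub_sub_cancel, hn]
  have hy := h _ hx hz
  rw [mem_closedBall_iff_norm, show z + k • n - (z - n) = (1 + k) • n by module, hnorm] at hy
  linarith [(abs_le.1 hy).2]

lemma exists_eq_add_smul_of_mem_unitSpindle (hy : y ∈ unitSpindle x z) (hzx : ‖z - x‖ ≤ 2)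
    (harea : area e (z - x) (y - x) = 0) :
    ∃ κ ∈ Icc (0 : ℝ) 1, y = x + κ • (z - x) := by
  rcases eq_or_ne (z - x) 0 with h0 | h0
  · obtain ⟨θ, -, hθ⟩ := exists_eq_norm_smul_circlePoint (e := e) (y - z) 0
    have := nonpos_of_add_smul_mem_unitSpindle (norm_circlePoint (e := e) θ) (l := 0)
      (by rw [h0, zero_smul]) ⟨le_rfl, zero_le_two⟩ (by rwa [← hθ, add_sub_cancel])
    rw [norm_le_zero_iff, sub_eq_zero] at this
    exact ⟨0, ⟨le_rfl, zero_le_one⟩, by rw [zero_smul, add_zero, this, sub_eq_zero.1 h0]⟩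
  have hd := norm_pos_iff.2 h0
  obtain ⟨κ, hκ⟩ : ∃ κ : ℝ, y = x + κ • (z - x) := by
    obtain ⟨V, hV, -⟩ := exists_area_eq_norm (e := e) (z - x)
    have h := area_smul_eq (e := e) (z - x) V (y - x)
    rw [harea, zero_smul, add_zero, hV] at h
    refine ⟨‖z - x‖⁻¹ * area e (y - x) V, ?_⟩
    rw [mul_smul, ← h, inv_smul_smul₀ hd.ne', add_sub_cancel]
  obtain ⟨θ, -, hθ⟩ := exists_eq_norm_smul_circlePoint (e := e) (z - x) 0
  have h1 : (κ - 1) * ‖z - x‖ ≤ 0 := by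
    refine nonpos_of_add_smul_mem_unitSpindle (norm_circlePoint (e := e) θ) hθ
      ⟨norm_nonneg _, hzx⟩ ?_
    rwa [mul_smul, ← hθ, show z + (κ - 1) • (z - x) = x + κ • (z - x) by module, ← hκ]
  have h2 : -κ * ‖z - x‖ ≤ 0 := by
    refine nonpos_of_add_smul_mem_unitSpindle (z := x) (x := z) (l := ‖z - x‖)
      (norm_circlePoint (e := e) (θ + π)) ?_ ⟨norm_nonneg _, hzx⟩ ?_
    · rw [circlePoint_add_pi, smul_neg, ← hθ, neg_sub]
    · rwa [circlePoint_add_pi, smul_neg, mul_smul, ← hθ, neg_smul, neg_neg, ← hκ, unitSpindle_comm]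
  exact ⟨κ, ⟨by nlinarith, by nlinarith⟩, hκ⟩

lemma IsChord.minArcLength_smul_add_le (h : IsChord e d s t)
    (hmin : arcLength e s t = minArcLength e d) (hθ : θ ∈ Icc s t) (hr : r ∈ Icc (0 : ℝ) 1) :
    minArcLength e (r • (circlePoint e θ - circlePoint e s)) +
      minArcLength e (d - r • (circlePoint e θ - circlePoint e s)) ≤ minArcLength e d := by
  have h₁ : IsChord e (circlePoint e θ - circlePoint e s) s θ :=
    ⟨hθ.1, hθ.2.trans h.le_add_pi, rfl⟩
  have h₂ : IsChord e (circlePoint e t - circlePoint e θ) θ t :=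
    ⟨hθ.2, h.le_add_pi.trans (by linarith [hθ.1]), rfl⟩
  have hsplit : d - r • (circlePoint e θ - circlePoint e s) =
      (1 - r) • d + r • (circlePoint e t - circlePoint e θ) := by
    rw [← h.sub_eq]
    module
  have hconv := (convexOn_minArcLength (e := e)).2 (mem_closedBall_zero_iff.2 h.norm_le_two)
    (mem_closedBall_zero_iff.2 h₂.norm_le_two) (sub_nonneg.2 hr.2) hr.1 (sub_add_cancel 1 r)
  rw [hsplit]
  calc _ ≤ r * minArcLength e (circlePoint e θ - circlePoint e s) +
        ((1 - r) * minArcLength e d + r * minArcLength e (circlePoint e t - circlePoint e θ)) :=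
        add_le_add (minArcLength_smul_le h₁.norm_le_two hr) hconv
    _ ≤ r * arcLength e s θ + ((1 - r) * minArcLength e d + r * arcLength e θ t) := by
        have := hr.1
        gcongr
        exacts [h₁.minArcLength_le, h₂.minArcLength_le]
    _ = minArcLength e d := by
        rw [← hmin, ← arcLength_add s θ t]
        ring

lemma minArcLength_add_le_of_area_neg (hy : y ∈ unitSpindle x z) (hzx : ‖z - x‖ ≤ 2)
    (harea : area e (z - x) (y - x) < 0) :
    minArcLength e (y - x) + minArcLength e (z - y) ≤ minArcLength e (z - x) := by
  obtain ⟨s, t, h, hmin⟩ := exists_isChord_arcLength_eq_minArcLength (e := e) hzx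
  have hY : ‖y - x + circlePoint e s‖ ≤ 1 := by
    have := hy (x - circlePoint e s) ?_ ?_
    · rwa [mem_closedBall_iff_norm, ← sub_add] at this
    · rw [mem_closedBall_iff_norm, sub_sub_cancel, norm_circlePoint]
    · rw [mem_closedBall_iff_norm, ← sub_add, ← h.sub_eq, sub_add_cancel, norm_circlePoint]
  have hne : y - x + circlePoint e s ≠ circlePoint e s := fun h0 ↦ by
    rw [add_eq_right.1 h0, map_zero] at harea
    exact harea.false
  -- The ray from `circlePoint e s` through the translate of `y` leaves the ball on the short arc.
  obtain ⟨q, hq, r, hr, hYq⟩ := exists_norm_eq_one_lineMap_eq (norm_circlePoint s).le hY hne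
  obtain ⟨θ, hθ, hqθ⟩ := exists_eq_norm_smul_circlePoint (e := e) q s
  rw [hq, one_smul] at hqθ
  have hyx : y - x = r • (circlePoint e θ - circlePoint e s) := by
    rwa [AffineMap.lineMap_apply_module', hqθ, add_right_cancel_iff] at hYq
  have hθt : θ ≤ t := by
    by_contra! hlt
    have hnn := area_sub_circlePoint_nonneg (e := e) h.le h.le_add_pi hlt.le hθ.2.le
    rw [hyx, ← h.sub_eq, map_smul, smul_eq_mul] at harea
    exact harea.not_ge (mul_nonneg hr.1.le hnn)
  have := h.minArcLength_smul_add_le hmin ⟨hθ.1, hθt⟩ ⟨hr.1.le, hr.2⟩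
  rwa [← hyx, sub_sub_sub_cancel_right] at this

theorem minArcLength_add_le_of_mem_unitSpindle (hy : y ∈ unitSpindle x z) (hzx : ‖z - x‖ ≤ 2) :
    minArcLength e (y - x) + minArcLength e (z - y) ≤ minArcLength e (z - x) := by
  rcases lt_trichotomy (area e (z - x) (y - x)) 0 with harea | harea | harea
  · exact minArcLength_add_le_of_area_neg hy hzx harea
  · obtain ⟨κ, hκ, rfl⟩ := exists_eq_add_smul_of_mem_unitSpindle hy hzx harea
    have h1 := minArcLength_smul_le (e := e) hzx hκ
    have h2 := minArcLength_smul_le (e := e) hzx (r := 1 - κ)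
      ⟨sub_nonneg.2 hκ.2, sub_le_self 1 hκ.1⟩
    rw [add_sub_cancel_left, show z - (x + κ • (z - x)) = (1 - κ) • (z - x) by module]
    linarith
  · rw [unitSpindle_comm] at hy
    have h := minArcLength_add_le_of_area_neg (e := e) hy (norm_sub_rev z x ▸ hzx) ?_
    · rw [← minArcLength_neg (z - x), ← minArcLength_neg (z - y), ← minArcLength_neg (y - x),
        neg_sub, neg_sub, neg_sub, add_comm]
      exact h
    · rw [← neg_sub z x, LinearMap.map_neg₂, ← sub_add_sub_cancel y x z, map_add,
        ← neg_sub z x, map_neg, area_self]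
      linarith

end UnitSpindle

section Outside

variable {E : Type*} [NormedAddCommGroup E] [NormedSpace ℝ E] {e : ℂ ≃L[ℝ] E} {s t τ : ℝ}
  {S T V x y z : E}

lemma IsSupport.area_sub_circlePoint_nonpos (hS : IsSupport e s S) (hT : IsSupport e t T)
    (h : IsChord e (z - x) s t) (hx : ‖x‖ ≤ 1) (hz : ‖z‖ ≤ 1) (hSV : 0 < area e S V)
    (hVT : 0 < area e V T) (hST : 0 < area e S T) : area e (x - circlePoint e s) V ≤ 0 := by
  have hxS : area e (x - circlePoint e s) S ≤ 0 := by
    rw [LinearMap.map_sub₂, hS.eq_one, sub_nonpos]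
    exact (hS.le_norm x).trans hx
  have hxT : area e (x - circlePoint e s) T ≤ 0 := by
    have hzx : x - circlePoint e s = z - circlePoint e t := by
      rw [sub_eq_sub_iff_sub_eq_sub, ← neg_sub z x, ← h.sub_eq, neg_sub]
    rw [hzx, LinearMap.map_sub₂, hT.eq_one, sub_nonpos]
    exact (hT.le_norm z).trans hz
  have hV := area_mul_area_eq_add (e := e) S T (x - circlePoint e s) V
  exact nonpos_of_mul_nonpos_right (hV ▸ add_nonpos
    (mul_nonpos_of_nonneg_of_nonpos hVT.le hxS) (mul_nonpos_of_nonneg_of_nonpos hSV.le hxT)) hST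

lemma IsSupport.arcLength_le_minArcLength_add (hS : IsSupport e s S) (hV : IsSupport e τ V)
    (hT : IsSupport e t T) (hτ : τ ∈ Icc s t) (hSV : 0 < area e S V) (hVT : 0 < area e V T)
    (hST : 0 < area e S T) (h : IsChord e (z - x) s t) (hx : ‖x‖ ≤ 1) (hz : ‖z‖ ≤ 1)
    (hy : 1 ≤ area e y V) (hyx : ‖y - x‖ ≤ 2) (hzy : ‖z - y‖ ≤ 2) :
    arcLength e s t ≤ minArcLength e (y - x) + minArcLength e (z - y) := by
  have hts := h.le_add_pi
  have h₁ := (hS.isArcFunctional_normInterp hV hτ.1 (hτ.2.trans hts) hSV).le_minArcLength hτ.1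
    (by linarith [hτ.2, pi_pos]) hyx
  have h₂ := (hV.isArcFunctional_normInterp hT hτ.2 (by linarith [hτ.1]) hVT).le_minArcLength hτ.2
    (by linarith [hτ.1, pi_pos]) hzy
  set w := y - x - (circlePoint e τ - circlePoint e s) with hw
  have hzyw : z - y - (circlePoint e t - circlePoint e τ) = -w := by
    rw [hw, ← sub_sub_sub_cancel_right z y x, ← h.sub_eq]
    abel
  have hwV : 0 ≤ area e w V := by
    have hxV := hS.area_sub_circlePoint_nonpos hT h hx hz hSV hVT hST
    rw [show w = y - circlePoint e τ - (x - circlePoint e s) by rw [hw]; abel,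
      LinearMap.map_sub₂, LinearMap.map_sub₂, hV.eq_one]
    linarith
  have hle := normInterp_le_normInterp hSV hVT hwV
  have hadd := arcLength_add (e := e) s τ t
  rw [hzyw, map_neg] at h₂
  linarith

lemma arcLength_le_minArcLength_add_of_area_pos (hS : IsSupport e s S) (hT : IsSupport e t T)
    (hST : 0 < area e S T) (h : IsChord e (z - x) s t) (hx : ‖x‖ ≤ 1) (hz : ‖z‖ ≤ 1)
    (hV : ∀ w, area e w V ≤ ‖w‖) (hyV : area e y V = ‖y‖) (hy : 1 ≤ ‖y‖) (hyx : ‖y - x‖ ≤ 2)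
    (hzy : ‖z - y‖ ≤ 2) (hSV : 0 < area e S V) (hVT : 0 < area e V T) :
    arcLength e s t ≤ minArcLength e (y - x) + minArcLength e (z - y) := by
  obtain ⟨φ, -, hφ⟩ := exists_eq_norm_smul_circlePoint (e := e) y 0
  have hφV : IsSupport e φ V := by
    refine ⟨mul_left_cancel₀ (zero_lt_one.trans_le hy).ne' ?_, hV⟩
    rw [← smul_eq_mul, ← LinearMap.map_smul₂, ← hφ, hyV, mul_one]
  obtain ⟨τ, hτ, hτV⟩ := hS.exists_mem_Icc hT hφV h.le hSV hVT hST
  exact hS.arcLength_le_minArcLength_add hτV hT hτ hSV hVT hST h hx hz (hyV ▸ hy) hyx hzy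

lemma IsChord.arcLength_le_minArcLength_add {u : E →ₗ[ℝ] ℝ} {c d : E} (h : IsChord e d s t)
    (hu : IsArcFunctional e s t u) (hc : ‖c‖ ≤ 2) (hdc : ‖d - c‖ ≤ 2) (huc : u c ≤ ‖c‖) :
    arcLength e s t ≤ minArcLength e c + minArcLength e (d - c) := by
  have hle := hu.le_minArcLength h.le (by linarith [h.le_add_pi, pi_pos]) hdc
  rw [h.sub_eq, sub_sub_cancel_left, map_neg] at hle
  linarith [norm_le_minArcLength (e := e) hc]

lemma area_pos_or_area_neg {a b : E} (hST : 0 < area e S T) (hV : V ≠ 0) (haS : area e a S < 0)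
    (haT : 0 < area e a T) (hbS : area e b S < 0) (hbT : 0 < area e b T) (haV : 0 ≤ area e a V)
    (hbV : area e b V ≤ 0) :
    0 < area e S V ∧ 0 < area e V T ∨ area e S V < 0 ∧ area e V T < 0 := by
  have ha := mul_nonneg hST.le haV
  have hb := mul_nonpos_of_nonneg_of_nonpos hST.le hbV
  rw [area_mul_area_eq_add] at ha hb
  rcases lt_trichotomy (area e V T) 0 with hVT | hVT | hVT
  · exact Or.inr ⟨by nlinarith, hVT⟩
  · refine absurd ?_ hV
    rw [hVT, zero_mul, zero_add] at ha hb
    have hSV : area e S V = 0 := le_antisymm (nonpos_of_mul_nonpos_left hb hbT)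
      (nonneg_of_mul_nonneg_left ha haT)
    have h := area_smul_eq (e := e) S T V
    rwa [hSV, hVT, zero_smul, zero_smul, zero_add, smul_eq_zero_iff_right hST.ne'] at h
  · exact Or.inl ⟨by nlinarith, hVT⟩

lemma arcLength_le_minArcLength_add_of_area_neg_of_area_pos (hS : IsSupport e s S)
    (hT : IsSupport e t T) (hST : 0 < area e S T) (h : IsChord e (z - x) s t)
    (hx : ‖x‖ ≤ 1) (hz : ‖z‖ ≤ 1) (hy : 1 ≤ ‖y‖)
    (hyx : ‖y - x‖ ≤ 2) (hzy : ‖z - y‖ ≤ 2) (hyxS : area e (y - x) S < 0)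
    (hyxT : 0 < area e (y - x) T) (hzyS : area e (z - y) S < 0) (hzyT : 0 < area e (z - y) T) :
    arcLength e s t ≤ minArcLength e (y - x) + minArcLength e (z - y) := by
  obtain ⟨V, hyV, hV⟩ := exists_area_eq_norm (e := e) y
  have hV0 : V ≠ 0 := by
    rintro rfl
    rw [map_zero] at hyV
    linarith
  have hyxV : 0 ≤ area e (y - x) V := by
    rw [LinearMap.map_sub₂, hyV]
    linarith [hV x]
  have hzyV : area e (z - y) V ≤ 0 := by
    rw [LinearMap.map_sub₂, hyV]
    linarith [hV z]
  rcases area_pos_or_area_neg hST hV0 hyxS hyxT hzyS hzyT hyxV hzyV with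
    ⟨hSV, hVT⟩ | ⟨hSV, hVT⟩
  · exact arcLength_le_minArcLength_add_of_area_pos hS hT hST h hx hz hV hyV hy hyx hzy hSV hVT
  -- The reflection in the origin exchanges the roles of `x` and `z`.
  · have hle := arcLength_le_minArcLength_add_of_area_pos (e := e) (x := -z) (y := -y) (z := -x)
      (V := -V) hS hT hST (by rwa [neg_sub_neg]) (by rwa [norm_neg]) (by rwa [norm_neg])
      (fun w ↦ by simpa using hV (-w)) (by simpa using hyV) (by rwa [norm_neg])
      (by rwa [neg_sub_neg]) (by rwa [neg_sub_neg]) (by simpa using hSV) (by simpa using hVT)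
    rwa [neg_sub_neg, neg_sub_neg, add_comm] at hle

lemma minArcLength_sub_le_add_of_norm_lt_two (hx : ‖x‖ ≤ 1) (hz : ‖z‖ ≤ 1) (hy : 1 ≤ ‖y‖)
    (hyx : ‖y - x‖ ≤ 2) (hzy : ‖z - y‖ ≤ 2) (hzx : ‖z - x‖ < 2) :
    minArcLength e (z - x) ≤ minArcLength e (y - x) + minArcLength e (z - y) := by
  obtain ⟨s, t, h, hmin⟩ := exists_isChord_arcLength_eq_minArcLength (e := e) hzx.le
  rw [← hmin]
  rcases h.le.eq_or_lt with rfl | hst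
  · rw [arcLength_self]
    exact add_nonneg (minArcLength_nonneg _) (minArcLength_nonneg _)
  have hsplit : z - x - (y - x) = z - y := sub_sub_sub_cancel_right z y x
  have hsplit' : z - x - (z - y) = y - x := sub_sub_sub_cancel_left x y z
  obtain ⟨S, hS⟩ := exists_isSupport (e := e) s
  obtain ⟨T, hT⟩ := exists_isSupport (e := e) t
  rcases (hS.area_nonneg hT hst (h.lt_add_pi hzx)).eq_or_lt with hzero | hST
  · obtain rfl := hS.eq_of_area_eq_zero hT hzero.symm (by rwa [h.sub_eq])
    obtain ⟨u, hu, hle⟩ := hS.exists_isArcFunctional_of_eq hT h.le_add_pi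
    simpa only [hsplit] using h.arcLength_le_minArcLength_add hu hyx (hsplit ▸ hzy) (hle _)
  have hu := hS.isArcFunctional_normInterp hT hst.le h.le_add_pi hST
  by_cases hyxST : 0 ≤ area e (y - x) S ∨ area e (y - x) T ≤ 0
  · simpa only [hsplit] using h.arcLength_le_minArcLength_add hu hyx (hsplit ▸ hzy)
      (normInterp_le_norm hST hyxST)
  by_cases hzyST : 0 ≤ area e (z - y) S ∨ area e (z - y) T ≤ 0
  · simpa only [hsplit', add_comm] using h.arcLength_le_minArcLength_add hu hzy (hsplit' ▸ hyx)
      (normInterp_le_norm hST hzyST)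
  push Not at hyxST hzyST
  exact arcLength_le_minArcLength_add_of_area_neg_of_area_pos hS hT hST h hx hz hy hyx hzy
    hyxST.1 hyxST.2 hzyST.1 hzyST.2

theorem minArcLength_sub_le_add (hx : ‖x‖ ≤ 1) (hz : ‖z‖ ≤ 1) (hy : 1 ≤ ‖y‖)
    (hyx : ‖y - x‖ ≤ 2) (hzy : ‖z - y‖ ≤ 2) :
    minArcLength e (z - x) ≤ minArcLength e (y - x) + minArcLength e (z - y) := by
  have hzx : ‖z - x‖ ≤ 2 := (norm_sub_le z x).trans (by linarith)
  refine minArcLength_le_of_forall_smul_le hzx fun r hr ↦ ?_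
  have hy0 : 0 < ‖y‖ := zero_lt_one.trans_le hy
  set k := (1 - r) / ‖y‖
  have hk0 : 0 ≤ k := div_nonneg (sub_nonneg.2 hr.2.le) hy0.le
  have hky : k * ‖y‖ = 1 - r := div_mul_cancel₀ _ hy0.ne'
  have hball : ∀ p : E, ‖p‖ ≤ 1 → ‖r • p + k • y‖ ≤ 1 := fun p hp ↦ by
    refine (norm_add_le _ _).trans ?_
    rw [norm_smul_of_nonneg hr.1, norm_smul_of_nonneg hk0, hky]
    nlinarith [hr.1]
  have hyk : 1 ≤ ‖(r + k) • y‖ := by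
    rw [norm_smul_of_nonneg (add_nonneg hr.1 hk0), add_mul, hky]
    nlinarith [hr.1]
  have hyx' : (r + k) • y - (r • x + k • y) = r • (y - x) := by module
  have hzy' : r • z + k • y - (r + k) • y = r • (z - y) := by module
  have hzx' : r • z + k • y - (r • x + k • y) = r • (z - x) := by module
  have main := minArcLength_sub_le_add_of_norm_lt_two (e := e) (hball x hx) (hball z hz) hyk
    (hyx' ▸ (norm_smul_lt_two hyx hr).le) (hzy' ▸ (norm_smul_lt_two hzy hr).le)
    (hzx' ▸ norm_smul_lt_two hzx hr)
  rw [hyx', hzy', hzx'] at main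
  have hr' := Ico_subset_Icc_self hr
  calc minArcLength e (r • (z - x)) ≤ r * minArcLength e (y - x) + r * minArcLength e (z - y) :=
        main.trans (add_le_add (minArcLength_smul_le hyx hr') (minArcLength_smul_le hzy hr'))
    _ ≤ minArcLength e (y - x) + minArcLength e (z - y) :=
        add_le_add (mul_le_of_le_one_left (minArcLength_nonneg _) hr.2.le)
          (mul_le_of_le_one_left (minArcLength_nonneg _) hr.2.le)

theorem minArcLength_le_add_of_notMem_interior_unitSpindle (hy : y ∉ interior (unitSpindle x z))
    (hyx : ‖y - x‖ ≤ 2) (hzy : ‖z - y‖ ≤ 2) :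
    minArcLength e (z - x) ≤ minArcLength e (y - x) + minArcLength e (z - y) := by
  have : FiniteDimensional ℝ E := e.toLinearEquiv.finiteDimensional
  have : ProperSpace E := FiniteDimensional.proper_real E
  obtain ⟨v, hx, hz, hyv⟩ := exists_one_le_norm_sub_of_notMem_interior_unitSpindle hy
  rw [← sub_sub_sub_cancel_right y x v] at hyx ⊢
  rw [← sub_sub_sub_cancel_right z y v] at hzy ⊢
  rw [← sub_sub_sub_cancel_right z x v]
  exact minArcLength_sub_le_add (mem_closedBall_iff_norm.1 hx) (mem_closedBall_iff_norm.1 hz)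
    hyv hyx hzy

end Outside

section Arc

variable {E : Type*} [NormedAddCommGroup E]

lemma eVariationOn_const_add {α : Type*} [LinearOrder α] (v : E) (f : α → E) (s : Set α) :
    eVariationOn (fun r ↦ v + f r) s = eVariationOn f s := by
  simp only [eVariationOn, edist_add_left]

variable [NormedSpace ℝ E] {e : ℂ ≃L[ℝ] E} {γ : ℝ → E} {a b : ℝ}

lemma exists_continuous_circlePoint_comp_eq {A : Type*} [TopologicalSpace A]
    [SimplyConnectedSpace A] [LocallyPathConnectedSpace A] {γ : A → E} (hγ : Continuous γ)
    (hγ1 : ∀ r, ‖γ r‖ = 1) : ∃ φ : A → ℝ, Continuous φ ∧ circlePoint e ∘ φ = γ := by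
  have hγ0 : ∀ r, e.symm (γ r) ≠ 0 := fun r h ↦ by
    have hr := hγ1 r
    rw [(map_eq_zero_iff _ e.symm.injective).1 h, norm_zero] at hr
    exact zero_ne_one hr
  let f : C(A, {z : ℂ // z ≠ 0}) :=
    ⟨fun r ↦ ⟨e.symm (γ r), hγ0 r⟩, (e.symm.continuous.comp hγ).subtype_mk hγ0⟩
  obtain ⟨a₀⟩ : Nonempty A := inferInstance
  obtain ⟨F, ⟨-, hF⟩, -⟩ := Complex.isCoveringMap_exp.existsUnique_continuousMap_lifts f a₀
    (Complex.log (e.symm (γ a₀))) (Subtype.ext (Complex.exp_log (hγ0 a₀)))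
  refine ⟨fun r ↦ (F r).im, Complex.continuous_im.comp F.continuous, funext fun r ↦ ?_⟩
  have hexp : γ r = rexp (F r).re • e (Circle.exp (F r).im) := by
    rw [← map_smul, Circle.coe_exp, Complex.real_smul, Complex.ofReal_exp, ← Complex.exp_add,
      Complex.re_add_im, ← e.apply_symm_apply (γ r)]
    exact congrArg e (congrArg Subtype.val (congrFun hF r)).symm
  rw [Function.comp_apply, circlePoint, ← NormedSpace.normalize_smul_of_pos (exp_pos (F r).re),
    ← hexp, NormedSpace.normalize, hγ1, inv_one, one_smul]

theorem ofReal_minArcLength_le_eVariationOn (hab : a ≤ b) (hγ : ContinuousOn γ (Icc a b))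
    (hinj : InjOn γ (Icc a b)) (hγ1 : ∀ r ∈ Icc a b, ‖γ r‖ = 1) :
    ENNReal.ofReal (minArcLength e (γ b - γ a)) ≤ eVariationOn γ (Icc a b) := by
  have ha := left_mem_Icc.2 hab
  have hb := right_mem_Icc.2 hab
  obtain ⟨φ, hφ, hφγ⟩ := exists_continuous_circlePoint_comp_eq (e := e)
    (hγ.domRestrict.Icc_extend' (h := hab)) fun r ↦ hγ1 _ (projIcc a b hab r).2
  have hφ_eq : EqOn (circlePoint e ∘ φ) γ (Icc a b) := fun r hr ↦ by
    rw [hφγ, IccExtend_of_mem hab _ hr, domRestrict_apply]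
  have hφinj : InjOn φ (Icc a b) := fun r hr r' hr' h ↦
    hinj hr hr' (by rw [← hφ_eq hr, ← hφ_eq hr', Function.comp_apply, h, Function.comp_apply])
  rw [← hφ_eq ha, ← hφ_eq hb, ← eVariationOn.eq_of_eqOn hφ_eq, Function.comp_apply,
    Function.comp_apply]
  rcases hφ.continuousOn.strictMonoOn_of_injOn_Icc' hab hφinj with hmono | hanti
  · have hle := hmono.monotoneOn ha hb hab
    rw [eVariationOn.comp_eq_of_monotoneOn _ _ hmono.monotoneOn,
      hφ.continuousOn.image_Icc_of_monotoneOn hab hmono.monotoneOn,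
      eVariationOn_circlePoint_Icc hle]
    exact ENNReal.ofReal_le_ofReal (minArcLength_le_arcLength hle)
  · have hle := hanti.antitoneOn ha hb hab
    rw [eVariationOn.comp_eq_of_antitoneOn _ _ hanti.antitoneOn,
      hφ.continuousOn.image_Icc_of_antitoneOn hab hanti.antitoneOn,
      eVariationOn_circlePoint_Icc hle, ← minArcLength_neg, neg_sub]
    exact ENNReal.ofReal_le_ofReal (minArcLength_le_arcLength hle)

end Arc

section Body

variable {C : Set Plane}

namespace IsSymmPlaneBody

lemma balanced (hC : IsSymmPlaneBody C) : Balanced ℝ C :=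
  (balanced_iff_neg_mem hC.convex).2 fun _ hx ↦ by rwa [← hC.neg_eq, Set.neg_mem_neg]

lemma mem_nhds_zero (hC : IsSymmPlaneBody C) : C ∈ 𝓝 0 := by
  obtain ⟨a, ha⟩ := hC.interior_nonempty
  have hmid := hC.convex.combo_interior_self_mem_interior ha
    (hC.balanced.neg_mem_iff.2 (interior_subset ha)) one_half_pos one_half_pos.le (add_halves 1)
  rw [smul_neg, add_neg_cancel] at hmid
  exact mem_interior_iff_mem_nhds.1 hmid

/-- The plane as a normed space with unit disk `C`, on a type of its own because `Plane` already
carries the Euclidean norm. -/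
def NormedPlane (_ : IsSymmPlaneBody C) : Type := Plane

variable (hC : IsSymmPlaneBody C)

noncomputable instance : AddCommGroup hC.NormedPlane := inferInstanceAs (AddCommGroup Plane)

noncomputable instance : Module ℝ hC.NormedPlane := inferInstanceAs (Module ℝ Plane)

/-- The gauge of `C` as a norm. -/
noncomputable def gaugeNorm : AddGroupNorm hC.NormedPlane where
  __ := (gaugeSeminorm hC.balanced hC.convex
    (absorbent_nhds_zero hC.mem_nhds_zero)).toAddGroupSeminorm
  eq_zero_of_map_eq_zero' _ := (gauge_eq_zero (absorbent_nhds_zero hC.mem_nhds_zero)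
    ((NormedSpace.isVonNBounded_iff ℝ).2 hC.isCompact.isBounded)).1

noncomputable instance : NormedAddCommGroup hC.NormedPlane :=
  hC.gaugeNorm.toNormedAddCommGroup

noncomputable instance : NormedSpace ℝ hC.NormedPlane where
  norm_smul_le r w := (gauge_smul hC.balanced r w).le

/-- The identity map, from the Euclidean plane to the plane with unit disk `C`. -/
noncomputable def toNormedPlane : Plane ≃L[ℝ] hC.NormedPlane :=
  LinearEquiv.toContinuousLinearEquiv (F := hC.NormedPlane) (LinearEquiv.refl ℝ Plane)

/-- The coordinates of the plane with unit disk `C`, as a complex number. -/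
noncomputable def coords : ℂ ≃L[ℝ] hC.NormedPlane :=
  Complex.orthonormalBasisOneI.repr.toContinuousLinearEquiv.trans hC.toNormedPlane

lemma norm_toNormedPlane_sub (p q : Plane) :
    ‖hC.toNormedPlane q - hC.toNormedPlane p‖ = bodyDist C p q := rfl

lemma mem_vadd_iff (v w : Plane) :
    w ∈ v +ᵥ C ↔ hC.toNormedPlane w ∈ closedBall (hC.toNormedPlane v) 1 := by
  rw [mem_closedBall_iff_norm, norm_toNormedPlane_sub, bodyDist,
    gauge_le_one_iff_mem_closure hC.convex hC.mem_nhds_zero, hC.isCompact.isClosed.closure_eq,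
    mem_vadd_set_iff_neg_vadd_mem, vadd_eq_add, neg_add_eq_sub]

lemma mem_frontier_vadd_iff (v w : Plane) :
    w ∈ frontier (v +ᵥ C) ↔ ‖hC.toNormedPlane w - hC.toNormedPlane v‖ = 1 := by
  have hfrontier : frontier (v +ᵥ C) = v +ᵥ frontier C :=
    ((Homeomorph.addLeft v).image_frontier C).symm
  rw [norm_toNormedPlane_sub, bodyDist, gauge_eq_one_iff_mem_frontier hC.convex hC.mem_nhds_zero,
    hfrontier, mem_vadd_set_iff_neg_vadd_mem, vadd_eq_add, neg_add_eq_sub]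

lemma bodyLength_eq_eVariationOn (γ : ℝ → Plane) (a b : ℝ) :
    bodyLength C γ a b = eVariationOn (hC.toNormedPlane ∘ γ) (Icc a b) := by
  simp only [bodyLength, eVariationOn, Function.comp_apply, edist_dist, dist_eq_norm,
    norm_toNormedPlane_sub]

lemma isClosed_spindle (hC : IsSymmPlaneBody C) (x z : Plane) : IsClosed (spindle C x z) :=
  isClosed_iInter fun v ↦ isClosed_iInter fun _ ↦ isClosed_iInter fun _ ↦
    hC.isCompact.isClosed.vadd v

lemma spindle_eq_preimage_unitSpindle (x z : Plane) :
    spindle C x z =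
      hC.toNormedPlane ⁻¹' unitSpindle (hC.toNormedPlane x) (hC.toNormedPlane z) := by
  ext y
  simp only [spindle, unitSpindle, mem_iInter, mem_vadd_iff hC, mem_preimage, mem_ofPred_eq,
    hC.toNormedPlane.surjective.forall]

lemma interior_spindle_eq_preimage (x z : Plane) :
    interior (spindle C x z) =
      hC.toNormedPlane ⁻¹' interior (unitSpindle (hC.toNormedPlane x) (hC.toNormedPlane z)) := by
  rw [hC.spindle_eq_preimage_unitSpindle]
  exact (hC.toNormedPlane.toHomeomorph.preimage_interior _).symm

lemma ofReal_minArcLength_mem_arcLengths {p q : Plane} (h : bodyDist C p q ≤ 2) :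
    ENNReal.ofReal (minArcLength hC.coords (hC.toNormedPlane q - hC.toNormedPlane p)) ∈
      arcLengths C p q := by
  obtain ⟨s, t, hst, hlen⟩ := exists_isChord_arcLength_eq_minArcLength (e := hC.coords)
    (d := hC.toNormedPlane q - hC.toNormedPlane p) h
  let c : ℝ → Plane := hC.toNormedPlane.symm ∘ circlePoint hC.coords
  have hΦc (r : ℝ) : hC.toNormedPlane (c r) = circlePoint hC.coords r :=
    hC.toNormedPlane.apply_symm_apply _
  have hc : Continuous c := hC.toNormedPlane.symm.continuous.comp continuous_circlePoint
  have hinj : InjOn c (Icc s t) := hC.toNormedPlane.symm.injective.comp_injOn <|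
    (circlePoint_injOn s).mono <| Icc_subset_Ico_right (by linarith [hst.le_add_pi, pi_pos])
  have hcst : c t - c s = q - p := hC.toNormedPlane.injective <| by
    rw [map_sub, map_sub, hΦc, hΦc, hst.sub_eq]
  refine ⟨p - c s, fun r ↦ p - c s + c r, s, t, ⟨hst.le, (continuous_const.add hc).continuousOn,
    fun r hr r' hr' hrr' ↦ hinj hr hr' (add_left_cancel hrr'), sub_add_cancel _ _, ?_,
    fun r _ ↦ ?_⟩, ?_⟩
  · simp only [sub_add_eq_add_sub, add_sub_assoc, hcst, add_sub_cancel]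
  · rw [mem_frontier_vadd_iff hC, ← map_sub, add_sub_cancel_left, hΦc, norm_circlePoint]
  · rw [bodyLength_eq_eVariationOn hC, ← hlen, ← eVariationOn_circlePoint_Icc hst.le,
      ← eVariationOn_const_add (hC.toNormedPlane (p - c s))]
    exact congrArg (eVariationOn · _) <| funext fun r ↦ by rw [Function.comp_apply, map_add, hΦc]

lemma ofReal_minArcLength_le_of_mem_arcLengths {p q : Plane} {l : ℝ≥0∞}
    (hl : l ∈ arcLengths C p q) :
    ENNReal.ofReal (minArcLength hC.coords (hC.toNormedPlane q - hC.toNormedPlane p)) ≤ l := by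
  obtain ⟨v, γ, a, b, ⟨hab, hγ, hinj, rfl, rfl, hγC⟩, rfl⟩ := hl
  have hle := ofReal_minArcLength_le_eVariationOn (e := hC.coords)
    (γ := fun r ↦ -hC.toNormedPlane v + hC.toNormedPlane (γ r)) hab
    (continuousOn_const.add (hC.toNormedPlane.continuous.comp_continuousOn hγ))
    (fun r hr r' hr' hrr' ↦ hinj hr hr' (hC.toNormedPlane.injective (add_left_cancel hrr')))
    (fun r hr ↦ by rw [neg_add_eq_sub]; exact (hC.mem_frontier_vadd_iff v _).1 (hγC r hr))
  rw [add_sub_add_left_eq_sub, eVariationOn_const_add] at hle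
  exact hle.trans_eq (hC.bodyLength_eq_eVariationOn γ a b).symm

lemma isLeast_arcLengths {p q : Plane} (h : bodyDist C p q ≤ 2) :
    IsLeast (arcLengths C p q)
      (ENNReal.ofReal (minArcLength hC.coords (hC.toNormedPlane q - hC.toNormedPlane p))) :=
  ⟨hC.ofReal_minArcLength_mem_arcLengths h, fun _ ↦ hC.ofReal_minArcLength_le_of_mem_arcLengths⟩

lemma arcDist_eq {p q : Plane} (h : bodyDist C p q ≤ 2) :
    arcDist C p q =
      ENNReal.ofReal (minArcLength hC.coords (hC.toNormedPlane q - hC.toNormedPlane p)) :=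
  (hC.isLeast_arcLengths h).csInf_eq

lemma arcDistAttained (hC : IsSymmPlaneBody C) {p q : Plane} (h : bodyDist C p q ≤ 2) :
    ArcDistAttained C p q := by
  rw [ArcDistAttained, hC.arcDist_eq h]
  exact ⟨hC.isLeast_arcLengths h, ENNReal.ofReal_ne_top⟩

variable {x y z : Plane}

theorem arcDist_add_le_of_mem_spindle (hC : IsSymmPlaneBody C)
    (hxy : bodyDist C x y ≤ 2) (hyz : bodyDist C y z ≤ 2) (hxz : bodyDist C x z ≤ 2)
    (hy : y ∈ spindle C x z) :
    arcDist C x y + arcDist C y z ≤ arcDist C x z := by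
  rw [hC.arcDist_eq hxy, hC.arcDist_eq hyz, hC.arcDist_eq hxz,
    ← ENNReal.ofReal_add (minArcLength_nonneg _) (minArcLength_nonneg _)]
  rw [hC.spindle_eq_preimage_unitSpindle] at hy
  exact ENNReal.ofReal_le_ofReal (minArcLength_add_le_of_mem_unitSpindle hy hxz)

theorem arcDist_le_add_of_notMem_interior_spindle (hC : IsSymmPlaneBody C)
    (hxy : bodyDist C x y ≤ 2) (hyz : bodyDist C y z ≤ 2) (hxz : bodyDist C x z ≤ 2)
    (hy : y ∉ interior (spindle C x z)) :
    arcDist C x z ≤ arcDist C x y + arcDist C y z := by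
  rw [hC.arcDist_eq hxy, hC.arcDist_eq hyz, hC.arcDist_eq hxz,
    ← ENNReal.ofReal_add (minArcLength_nonneg _) (minArcLength_nonneg _)]
  rw [hC.interior_spindle_eq_preimage] at hy
  exact ENNReal.ofReal_le_ofReal (minArcLength_le_add_of_notMem_interior_unitSpindle hy hxy hyz)

end IsSymmPlaneBody

end Body

theorem mainTheorem8_general (C : Set Plane) (hC : IsSymmPlaneBody C) (x y z : Plane)
    (hxy : bodyDist C x y ≤ 2) (hyz : bodyDist C y z ≤ 2) (hxz : bodyDist C x z ≤ 2) :
    (ArcDistAttained C x y ∧ ArcDistAttained C y z ∧ ArcDistAttained C x z) ∧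
    (y ∈ interior (spindle C x z) → arcDist C x y + arcDist C y z ≤ arcDist C x z) ∧
    (y ∈ frontier (spindle C x z) → arcDist C x y + arcDist C y z = arcDist C x z) ∧
    (y ∉ spindle C x z → arcDist C x y + arcDist C y z ≥ arcDist C x z) := by
  have hle := hC.arcDist_add_le_of_mem_spindle hxy hyz hxz
  have hge := hC.arcDist_le_add_of_notMem_interior_spindle hxy hyz hxz
  exact ⟨⟨hC.arcDistAttained hxy, hC.arcDistAttained hyz, hC.arcDistAttained hxz⟩,
    fun hy ↦ hle (interior_subset hy),
    fun hy ↦ le_antisymm (hle ((hC.isClosed_spindle x z).frontier_subset hy)) (hge hy.2),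
    fun hy ↦ hge fun hy_int ↦ hy (interior_subset hy_int)⟩

theorem mainTheorem8 (C : Set Plane) (hC : IsSymmPlaneBody C) (x y z : Plane)
    (hxy : bodyDist C x y ≤ 2) (hyz : bodyDist C y z ≤ 2) (hxz : bodyDist C x z ≤ 2) :
    (ArcDistAttained C x y ∧ ArcDistAttained C y z ∧ ArcDistAttained C x z) ∧
    (y ∈ interior (spindle C x z) → arcDist C x y + arcDist C y z ≤ arcDist C x z) ∧
    (y ∈ frontier (spindle C x z) → arcDist C x y + arcDist C y z = arcDist C x z) ∧
    (y ∉ spindle C x z → IsSmoothBody C →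
      arcDist C x y + arcDist C y z ≥ arcDist C x z) := by
  obtain ⟨hatt, hint, hfrontier, hout⟩ := mainTheorem8_general C hC x y z hxy hyz hxz
  exact ⟨hatt, hint, hfrontier, fun hy _ ↦ hout hy⟩
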